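/- Let $\lambda_1,\lambda_2\in(0,1]$. Consider discrete-time systems in which, independently over time slots and of each other, a data packet is received in a slot with probability $\lambda_1$, and an actuation permission is given (or, in the system with a battery, an energy unit can be harvested) with probability $\lambda_2$. A packet has age $1$ at the end of the slot in which it is received, and its age grows by $1$ in each later slot. A packet received in a slot may be actuated in that slot; an actuated packet leaves the queue. The Age of Actuated Information (AoAI) $AI(n)$ at the end of slot $n$ is $\min\{AI(n-1)+1,\,I_p(n)\}$ if a packet is actuated in slot $n$, where $I_p(n)$ is the age of that packet, and $AI(n-1)+1$ otherwise. The average AoAI $\overline{AI}$ is the expected value of the AoAI in steady state, i.e. under a stationary distribution of the Markov chain of end-of-slot states (the AoAI, the ages of the queued packets, and the state of the battery if there is one). (i) Geo/Geo/1 with a controller under FCFS (infinite queue; on permission the oldest packet, if any, is actuated): if $\lambda_1<\lambda_2$, a stationary distribution exists and $$\overline{AI}=\frac{\lambda_1^2(\lambda_2-1)(\lambda_1-\lambda_2)+\lambda_2^3(\lambda_1-1)}{\lambda_1(\lambda_1-\lambda_2)\lambda_2^2}.$$ (ii) Geo/Geo/1 with a controller under LCFS with preemption (infinite queue; on permission the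 freshest packet, if any, is actuated), and Geo/Geo/1/1 with a controller (single-packet buffer, in which a received packet replaces the stored one; on permission the packet, if any, is actuated): $$\overline{AI}=\frac1{\lambda_1}+\frac1{\lambda_2}-1 .$$ For Geo/Geo/1/1 a stationary distribution always exists. For LCFS one exists if $\lambda_1<\lambda_2$; moreover, for all $\lambda_1,\lambda_2\in(0,1]$ and from every initial state, the law of $AI(n)$ under LCFS converges as $n\to\infty$ to one probability distribution, independent of the initial state, whose mean is the above value, and $\mathbb E[AI(n)]$ converges to this value. (iii) Geo/Geo/1/1 with a battery that stores at most one energy unit (single-packet buffer as in (ii); an actuation takes place when there are a packet and an energy unit, stored or harvested in that slot, and consumes one unit; a harvested unit that is not consumed is stored if there is room, and lost otherwise; when the battery is full, an actuation consumes the stored unit and a unit harvested in the same slot is stored): if $(\lambda_1,\lambda_2)\neq(1,1)$, a stationary distribution exists and $\overline{AI}$ equals $$\frac{\lambda_1^4(\lambda_2-4)(\lambda_2-1)^3\lambda_2-4\lambda_1^3(\lambda_2-1)^3\lambda_2^2+\lambda_1(3-4\lambda_2)\lambda_2^4+\lambda_2^5+\lambda_1^5(\lambda_2-1)^3(2\lambda_2-1)+2\lambda_1^2\lambda_2^3(2-5\lambda_2+3\lambda_2^2)}{\lambda_1\lambda_2(\lambda_1+\lambda_2-\lambda_1\lambda_2)^2\left(\lambda_1^2(\lambda_2-1)^2+\lambda_2^2+\lambda_1(\lambda_2-2\lambda_2^2)\right)}.$$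 In every case the value of $\overline{AI}$ is the same for every stationary distribution. -/

import Mathlib

open Filter Topology

noncomputable section

namespace AoAI

/-- A slotted system with state space `S`, driven in every slot by two Boolean inputs: whether a
data packet is received (`Λ₁(n) = 1`), and whether an actuation permission is given, or an energy
unit can be harvested (`Λ₂(n) = 1`). `step s a b` is the state at the end of a slot that starts in
state `s` and has inputs `a`, `b`; `aoai s` is the Age of Actuated Information in state `s`. -/
structure SlottedSystem (S : Type) where
  step : S → Bool → Bool → S
  aoai : S → ℕ

/-- The probability that a Bernoulli variable with parameter `p` takes the value `b`. -/
def bern (p : ℝ) (b : Bool) : ℝ := if b then p else 1 - p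

namespace SlottedSystem

variable {S : Type}

/-- The transition operator `f ↦ (s ↦ E[f(X(n+1)) | X(n) = s])` of the Markov chain of end-of-slot
states, when the inputs of the slots are independent, `Λ₁(n)` is Bernoulli with parameter `l1`,
and `Λ₂(n)` is Bernoulli with parameter `l2`. -/
def transition (M : SlottedSystem S) (l1 l2 : ℝ) (f : S → ℝ) (s : S) : ℝ :=
  ∑ a : Bool, ∑ b : Bool, bern l1 a * bern l2 b * f (M.step s a b)

/-- `E[f(X(n)) | X(0) = s]`. -/
def expect (M : SlottedSystem S) (l1 l2 : ℝ) (n : ℕ) (f : S → ℝ) (s : S) : ℝ :=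
  (M.transition l1 l2)^[n] f s

open Classical in
/-- The one-step transition probability from `s` to `t`. -/
def transitionProb (M : SlottedSystem S) (l1 l2 : ℝ) (s t : S) : ℝ :=
  M.transition l1 l2 (fun u => if u = t then 1 else 0) s

/-- `V` is a stationary distribution of the chain: a probability vector with `V P = V`. -/
structure IsStationary (M : SlottedSystem S) (l1 l2 : ℝ) (V : S → ℝ) : Prop where
  nonneg : ∀ s, 0 ≤ V s
  total : HasSum V 1
  balance : ∀ t, HasSum (fun s => V s * M.transitionProb l1 l2 s t) (V t)

/-- The average AoAI in steady state is `v`: the chain has a stationary distribution, and the AoAI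
is integrable with expected value `v` under every stationary distribution. -/
def HasStationaryAverage (M : SlottedSystem S) (l1 l2 v : ℝ) : Prop :=
  (∃ V, M.IsStationary l1 l2 V) ∧
    ∀ V, M.IsStationary l1 l2 V → HasSum (fun s => (M.aoai s : ℝ) * V s) v

/-- The average AoAI in the limit is `v`, a notion that also makes sense when the rest of the state
has no steady state: whatever the initial state, the law of the AoAI at time `n` converges to one
and the same probability distribution on `ℕ`, whose mean is `v`, and the expected AoAI at time `n`
converges to `v`. -/
def HasLimitingAverage (M : SlottedSystem S) (l1 l2 v : ℝ) : Prop :=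
  (∃ p : ℕ → ℝ, (∀ k, 0 ≤ p k) ∧ HasSum p 1 ∧ HasSum (fun k : ℕ => (k : ℝ) * p k) v ∧
    ∀ s k, Tendsto (fun n => M.expect l1 l2 n (fun u => if M.aoai u = k then 1 else 0) s)
      atTop (𝓝 (p k))) ∧
  ∀ s, Tendsto (fun n => M.expect l1 l2 n (fun u => (M.aoai u : ℝ)) s) atTop (𝓝 v)

end SlottedSystem

/-- State of an infinite-capacity system: the AoAI, and the ages of the queued packets in the
order in which they are to be actuated. -/
structure QueueState where
  ai : ℕ
  queue : List ℕ

/-- State of a single-packet-buffer system with a controller: the AoAI, and the age of the stored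
not-yet-actuated packet, if there is one. -/
structure BufferState where
  ai : ℕ
  buffer : Option ℕ

/-- State of a single-packet-buffer system with a battery of size one: the AoAI, the age of the
stored packet, if there is one, and whether the battery is full. -/
structure BatteryState where
  ai : ℕ
  buffer : Option ℕ
  full : Bool

/-- Actuation in an infinite-capacity system, once the queue `q` of the slot (with current ages,
including a packet received in this slot) is known: on permission the first packet of `q` is
actuated, and the AoAI becomes the minimum of the old AoAI plus one and the age of that packet;
without an actuation the AoAI grows by one. -/
def actuateQueue (ai : ℕ) (q : List ℕ) (perm : Bool) : QueueState :=
  match perm, q with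
  | true, p :: q' => ⟨min (ai + 1) p, q'⟩
  | _, q => ⟨ai + 1, q⟩

/-- Geo/Geo/1 with a controller, FCFS: all ages grow by one, a received packet (of age 1 at the end
of the slot) joins the queue at the end, and on permission the oldest packet is actuated. -/
def fcfs : SlottedSystem QueueState where
  step s arrival perm :=
    actuateQueue s.ai (s.queue.map (· + 1) ++ if arrival then [1] else []) perm
  aoai := QueueState.ai

/-- Geo/Geo/1 with a controller, LCFS with preemption: the same, but a received packet joins the
queue at the front, so that on permission the freshest packet is actuated. -/
def lcfs : SlottedSystem QueueState where
  step s arrival perm :=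
    actuateQueue s.ai ((if arrival then [1] else []) ++ s.queue.map (· + 1)) perm
  aoai := QueueState.ai

/-- Content of a single-packet buffer before the actuation decision of a slot: a received packet
replaces the stored one, and otherwise the stored one ages by one. -/
def refresh (buffer : Option ℕ) (arrival : Bool) : Option ℕ :=
  if arrival then some 1 else buffer.map (· + 1)

/-- Geo/Geo/1/1 with a controller (with preemption). -/
def singleBuffer : SlottedSystem BufferState where
  step s arrival perm :=
    match perm, refresh s.buffer arrival with
    | true, some p => ⟨min (s.ai + 1) p, none⟩
    | _, buf => ⟨s.ai + 1, buf⟩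
  aoai := BufferState.ai

/-- Geo/Geo/1/1 with a battery of size one: an actuation takes place when there is a packet and an
energy unit, stored or harvested in this slot. An actuation uses one energy unit; the battery is
full afterwards only if it was full before and a unit is harvested. Without an actuation a
harvested unit is stored (and lost if the battery is full). -/
def battery : SlottedSystem BatteryState where
  step s arrival harvest :=
    match s.full || harvest, refresh s.buffer arrival with
    | true, some p => ⟨min (s.ai + 1) p, none, s.full && harvest⟩
    | energy, buf => ⟨s.ai + 1, buf, energy⟩
  aoai := BatteryState.ai

end AoAI

end

/-!
Existence of stationary distributions comes from a regeneration argument,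
`SlottedSystem.exists_isStationary`: if a state is hit again in finite mean time from everywhere,
which a function `W` with drift at most `-1` certifies, then the mean numbers of visits during an
excursion from that state are, after normalisation, a stationary distribution. For the two infinite
queues `W` is affine in the queue length, and for the single-packet buffers it is bounded.

The value of the average is found in two ways, neither of which uses uniqueness of the stationary
distribution or regularity (such as sorted queues) of the states that it charges.

* When the freshest packet is actuated, the AoAI at time `n` is `1` plus the time since the last
  permission plus the time between that permission and the last arrival before it, whatever the
  initial state, as long as this is at most `n`. Hence its probability of being `k` is *equal* to
  that of a sum of two independent geometric variables as soon as `n > k` (`freshest_law`,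
  `lcfs_law`, `singleBuffer_law`). This gives the limit statement for LCFS, since the AoAI grows at
  most linearly and the limiting law has tails `o(1 / n)`, and it gives the mean under every
  stationary distribution.
* For FCFS and for the battery, the Poisson equation `P g = g - AoAI + v` has an explicit solution
  `g`. If `g` is integrable, invariance yields the mean `v` (`IsStationary.hasSum_of_poisson`), and
  integrability follows from a Foster–Lyapunov bound (`IsStationary.summable_of_drift`). For FCFS,
  `g` is built from the sum of the running minima of the ages along the queue, from a quadratic
  polynomial in the queue length `n`, and from terms `y * z ^ n` and `z ^ n`, where `y` is the least
  age; it grows polynomially, and is dominated by a function `w ^ AoAI * x ^ n` with geometric drift.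
  For the battery, `g` is affine in the AoAI and the freshest age, with coefficients that depend on
  whether a packet and an energy unit are stored.
-/

namespace AoAI

/-! ### The transition operator -/

/-- Exchange of the order of summation of a nonnegative double series with known row and column
sums. -/
theorem hasSum_of_fiberwise_nonneg {α β : Type*} {F : α → β → ℝ} (h0 : ∀ a b, 0 ≤ F a b)
    {A : α → ℝ} {B : β → ℝ} {m : ℝ} (hA : ∀ a, HasSum (F a) (A a))
    (hB : ∀ b, HasSum (fun a => F a b) (B b)) (hm : HasSum A m) : HasSum B m := by
  have hs : Summable (fun p : α × β => F p.1 p.2) := by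
    refine (summable_prod_of_nonneg (fun p => h0 p.1 p.2)).2 ⟨fun a => (hA a).summable, ?_⟩
    exact hm.summable.congr fun a => ((hA a).tsum_eq).symm
  have h1 : HasSum (fun p : α × β => F p.1 p.2) m := by
    have := hs.hasSum.prod_fiberwise hA
    rw [hm.unique this]
    exact hs.hasSum
  have h2 : HasSum (fun p : β × α => F p.2 p.1) m :=
    ((Equiv.prodComm β α).hasSum_iff (f := fun p : α × β => F p.1 p.2)).2 h1
  exact h2.prod_fiberwise hB

theorem bern_nonneg {p : ℝ} (hp : p ∈ Set.Icc (0 : ℝ) 1) (b : Bool) : 0 ≤ bern p b := by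
  cases b <;> simp [bern, hp.1, hp.2]

namespace SlottedSystem

variable {S : Type} (M : SlottedSystem S) {l1 l2 : ℝ}

theorem transition_apply (f : S → ℝ) (s : S) :
    M.transition l1 l2 f s = l1 * l2 * f (M.step s true true)
      + l1 * (1 - l2) * f (M.step s true false) + (1 - l1) * l2 * f (M.step s false true)
      + (1 - l1) * (1 - l2) * f (M.step s false false) := by
  simp [transition, bern]
  ring

theorem transition_const (c : ℝ) (s : S) : M.transition l1 l2 (fun _ => c) s = c := by
  rw [transition_apply]; ring

theorem transition_add (f g : S → ℝ) (s : S) : M.transition l1 l2 (fun u => f u + g u) s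
    = M.transition l1 l2 f s + M.transition l1 l2 g s := by
  simp only [transition_apply]; ring

theorem transition_sub (f g : S → ℝ) (s : S) : M.transition l1 l2 (fun u => f u - g u) s
    = M.transition l1 l2 f s - M.transition l1 l2 g s := by
  simp only [transition_apply]; ring

theorem transition_mul_left (c : ℝ) (f : S → ℝ) (s : S) :
    M.transition l1 l2 (fun u => c * f u) s = c * M.transition l1 l2 f s := by
  simp only [transition_apply]; ring

variable {M}

theorem transition_le_transition (h1 : l1 ∈ Set.Icc (0 : ℝ) 1) (h2 : l2 ∈ Set.Icc (0 : ℝ) 1)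
    {f g : S → ℝ} {s : S} (h : ∀ a b, f (M.step s a b) ≤ g (M.step s a b)) :
    M.transition l1 l2 f s ≤ M.transition l1 l2 g s :=
  Finset.sum_le_sum fun a _ => Finset.sum_le_sum fun b _ =>
    mul_le_mul_of_nonneg_left (h a b) (mul_nonneg (bern_nonneg h1 a) (bern_nonneg h2 b))

theorem transition_nonneg (h1 : l1 ∈ Set.Icc (0 : ℝ) 1) (h2 : l2 ∈ Set.Icc (0 : ℝ) 1)
    {f : S → ℝ} (h : ∀ s, 0 ≤ f s) (s : S) : 0 ≤ M.transition l1 l2 f s := by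
  have := transition_le_transition (M := M) h1 h2 (f := fun _ => 0) (g := f) (s := s)
    fun a b => h _
  rwa [transition_const] at this

/-- The operator `f ↦ ∑ t, P(·, t) f(t)` is `transition`; the sum has at most four nonzero terms,
so no condition on `f` is needed. -/
theorem hasSum_transitionProb_mul (f : S → ℝ) (s : S) :
    HasSum (fun t => M.transitionProb l1 l2 s t * f t) (M.transition l1 l2 f s) := by
  classical
  simp only [transitionProb, transition, Finset.sum_mul]
  refine hasSum_sum fun a _ => hasSum_sum fun b _ => ?_
  have := hasSum_single (M.step s a b)
    (f := fun t => bern l1 a * bern l2 b * (if M.step s a b = t then 1 else 0) * f t)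
    (fun t ht => by simp [ht.symm])
  simpa using this

theorem transitionProb_nonneg (h1 : l1 ∈ Set.Icc (0 : ℝ) 1) (h2 : l2 ∈ Set.Icc (0 : ℝ) 1)
    (s t : S) : 0 ≤ M.transitionProb l1 l2 s t :=
  transition_nonneg h1 h2 (fun u => by positivity) s

/-! ### Invariance, drift and the Poisson equation for stationary distributions -/

namespace IsStationary

variable {V : S → ℝ}

theorem hasSum_transition_of_nonneg (hV : M.IsStationary l1 l2 V)
    (h1 : l1 ∈ Set.Icc (0 : ℝ) 1) (h2 : l2 ∈ Set.Icc (0 : ℝ) 1)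
    {f : S → ℝ} (hf : ∀ s, 0 ≤ f s) {m : ℝ} (hm : HasSum (fun s => V s * f s) m) :
    HasSum (fun s => V s * M.transition l1 l2 f s) m := by
  refine hasSum_of_fiberwise_nonneg (F := fun t s => V s * M.transitionProb l1 l2 s t * f t)
    (fun t s => mul_nonneg (mul_nonneg (hV.nonneg s) (transitionProb_nonneg h1 h2 s t)) (hf t))
    (fun t => (hV.balance t).mul_right (f t)) (fun s => ?_) hm
  simp only [mul_assoc]
  exact (hasSum_transitionProb_mul f s).mul_left _

/-- Invariance of a stationary distribution, `V(P f) = V(f)`, for integrable `f`. -/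
theorem hasSum_transition (hV : M.IsStationary l1 l2 V)
    (h1 : l1 ∈ Set.Icc (0 : ℝ) 1) (h2 : l2 ∈ Set.Icc (0 : ℝ) 1)
    {f : S → ℝ} {m : ℝ} (hm : HasSum (fun s => V s * f s) m) :
    HasSum (fun s => V s * M.transition l1 l2 f s) m := by
  have habs : Summable fun s => V s * |f s| := by
    refine hm.summable.abs.congr fun s => ?_
    rw [abs_mul, abs_of_nonneg (hV.nonneg s)]
  have hsum : Summable fun s => V s * (|f s| + f s) := by
    simpa only [mul_add] using habs.add hm.summable
  have ha := hV.hasSum_transition_of_nonneg h1 h2 (fun s => abs_nonneg (f s)) habs.hasSum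
  have hb := hV.hasSum_transition_of_nonneg h1 h2
    (fun s => by linarith [neg_abs_le (f s)]) hsum.hasSum
  have hm' : m = ∑' s, V s * (|f s| + f s) - ∑' s, V s * |f s| := by
    refine hm.unique ((hsum.hasSum.sub habs.hasSum).congr_fun ?_)
    intro s; ring
  rw [hm']
  refine (hb.sub ha).congr_fun ?_
  intro s
  rw [transition_add]; ring

/-- If `P g = g - f + v` for an integrable `g` (the Poisson equation), then `f` has mean `v`. -/
theorem hasSum_of_poisson (hV : M.IsStationary l1 l2 V)
    (h1 : l1 ∈ Set.Icc (0 : ℝ) 1) (h2 : l2 ∈ Set.Icc (0 : ℝ) 1)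
    {f g : S → ℝ} {v : ℝ} (hg : Summable fun s => V s * g s)
    (h : ∀ s, M.transition l1 l2 g s = g s - f s + v) : HasSum (fun s => f s * V s) v := by
  have := (hg.hasSum.sub (hV.hasSum_transition h1 h2 hg.hasSum)).add (hV.total.mul_left v)
  rw [sub_self, zero_add, mul_one] at this
  refine this.congr_fun fun s => ?_
  rw [h]; ring

theorem summable_of_bounded (hV : M.IsStationary l1 l2 V) {f : S → ℝ} {c : ℝ}
    (hf : ∀ s, |f s| ≤ c) : Summable fun s => V s * f s := by
  refine Summable.of_norm_bounded (hV.total.summable.mul_left c) fun s => ?_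
  rw [Real.norm_eq_abs, abs_mul, abs_of_nonneg (hV.nonneg s), mul_comm]
  exact mul_le_mul_of_nonneg_right (hf s) (hV.nonneg s)

theorem summable_of_le (hV : M.IsStationary l1 l2 V) {f g : S → ℝ} (c : ℝ)
    (hg : Summable fun s => V s * g s) (h : ∀ s, |f s| ≤ c * g s) :
    Summable fun s => V s * f s := by
  refine Summable.of_norm_bounded (hg.mul_left c) fun s => ?_
  rw [Real.norm_eq_abs, abs_mul, abs_of_nonneg (hV.nonneg s), mul_left_comm]
  exact mul_le_mul_of_nonneg_left (h s) (hV.nonneg s)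

/-- Foster–Lyapunov bound: if `P U ≤ U - f + C` with `U, f ≥ 0`, then `f` is integrable under every
stationary distribution, although `U` need not be. -/
theorem summable_of_drift (hV : M.IsStationary l1 l2 V)
    (h1 : l1 ∈ Set.Icc (0 : ℝ) 1) (h2 : l2 ∈ Set.Icc (0 : ℝ) 1)
    {U f : S → ℝ} {C : ℝ} (hU : ∀ s, 0 ≤ U s) (hf : ∀ s, 0 ≤ f s) (hC : 0 ≤ C)
    (h : ∀ s, M.transition l1 l2 U s ≤ U s - f s + C) : Summable fun s => V s * f s := by
  classical
  refine summable_of_sum_le (c := C) (fun s => mul_nonneg (hV.nonneg s) (hf s)) fun F => ?_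
  obtain ⟨B, hB⟩ : ∃ B, ∀ s ∈ F, U s ≤ B := by
    obtain ⟨B, hB⟩ := (F.image U).exists_le
    exact ⟨B, fun s hs => hB _ (Finset.mem_image_of_mem U hs)⟩
  -- The truncation `min U B` is bounded, so it has zero mean drift, and below level `B` its drift
  -- is at most that of `U`.
  set T : S → ℝ := fun s => min (U s) B with hT
  set φ : S → ℝ := fun s => if U s ≤ B then f s else 0 with hφ
  have hTb : ∀ s, |T s| ≤ |B| := fun s => by
    rcases le_total (U s) B with hs | hs
    · simp only [hT, min_eq_left hs]
      rw [abs_of_nonneg (hU s)]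
      exact hs.trans (le_abs_self B)
    · simp only [hT, min_eq_right hs]; exact le_rfl
  have hdrift : ∀ s, φ s ≤ T s - M.transition l1 l2 T s + C := fun s => by
    have hle : M.transition l1 l2 T s ≤ M.transition l1 l2 U s :=
      transition_le_transition h1 h2 fun _ _ => min_le_left _ _
    have hle' : M.transition l1 l2 T s ≤ B := by
      have := transition_le_transition (M := M) h1 h2 (f := T) (g := fun _ => B) (s := s)
        fun _ _ => min_le_right _ _
      rwa [transition_const] at this
    by_cases hs : U s ≤ B
    · simp only [hφ, hT, if_pos hs, min_eq_left hs] at hle ⊢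
      linarith [h s]
    · simp only [hφ, hT, if_neg hs, min_eq_right (not_le.1 hs).le] at hle' ⊢
      linarith
  have hTs := (hV.summable_of_bounded hTb).hasSum
  have htot := (hTs.sub (hV.hasSum_transition h1 h2 hTs)).add (hV.total.mul_left C)
  rw [sub_self, zero_add, mul_one] at htot
  have hnn : ∀ s, 0 ≤ φ s := fun s => by simp only [hφ]; split_ifs <;> simp [hf]
  calc ∑ s ∈ F, V s * f s = ∑ s ∈ F, V s * φ s :=
        Finset.sum_congr rfl fun s hs => by simp [hφ, hB s hs]
    _ ≤ ∑ s ∈ F, (V s * T s - V s * M.transition l1 l2 T s + C * V s) :=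
        Finset.sum_le_sum fun s _ => by
          have := mul_le_mul_of_nonneg_left (hdrift s) (hV.nonneg s)
          linarith
    _ ≤ C := sum_le_hasSum F (fun s _ => by
          have := mul_le_mul_of_nonneg_left ((hnn s).trans (hdrift s)) (hV.nonneg s)
          linarith) htot

end IsStationary

/-! ### Expectations after several slots -/

theorem expect_succ (n : ℕ) (f : S → ℝ) (s : S) :
    M.expect l1 l2 (n + 1) f s = M.transition l1 l2 (M.expect l1 l2 n f) s := by
  simp only [expect, Function.iterate_succ_apply']
  rfl

theorem expect_zero (f : S → ℝ) (s : S) : M.expect l1 l2 0 f s = f s := rfl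

theorem expect_add (n : ℕ) (f g : S → ℝ) (s : S) : M.expect l1 l2 n (fun u => f u + g u) s
    = M.expect l1 l2 n f s + M.expect l1 l2 n g s := by
  induction n generalizing s with
  | zero => rfl
  | succ n ih => simp only [expect_succ, ← transition_add]; congr 1; funext u; exact ih u

theorem expect_mul_left (n : ℕ) (c : ℝ) (f : S → ℝ) (s : S) :
    M.expect l1 l2 n (fun u => c * f u) s = c * M.expect l1 l2 n f s := by
  induction n generalizing s with
  | zero => rfl
  | succ n ih => simp only [expect_succ, ← transition_mul_left]; congr 1; funext u; exact ih u

theorem expect_const (n : ℕ) (c : ℝ) (s : S) : M.expect l1 l2 n (fun _ => c) s = c := by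
  induction n generalizing s with
  | zero => rfl
  | succ n ih =>
    rw [expect_succ, show M.expect l1 l2 n (fun _ => c) = fun _ => c from funext ih,
      transition_const]

theorem expect_sum {ι : Type*} (F : Finset ι) (n : ℕ) (f : ι → S → ℝ) (s : S) :
    M.expect l1 l2 n (fun u => ∑ i ∈ F, f i u) s = ∑ i ∈ F, M.expect l1 l2 n (f i) s := by
  classical
  induction F using Finset.induction_on with
  | empty => simpa using expect_const n 0 s
  | insert i F hi ih => simp only [Finset.sum_insert hi, expect_add, ih]

/-- If the AoAI has, after sufficiently many slots, exactly the probability `p k` of being `k`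
whatever the initial state, then it has law `p` under every stationary distribution. -/
theorem IsStationary.hasSum_aoai_of_law {V : S → ℝ} (hV : M.IsStationary l1 l2 V)
    (h1 : l1 ∈ Set.Icc (0 : ℝ) 1) (h2 : l2 ∈ Set.Icc (0 : ℝ) 1) {p : ℕ → ℝ} {v : ℝ}
    (hp : HasSum (fun k : ℕ => (k : ℝ) * p k) v)
    (hlaw : ∀ k, ∃ n, ∀ s, M.expect l1 l2 n (fun u => if M.aoai u = k then 1 else 0) s = p k) :
    HasSum (fun s => (M.aoai s : ℝ) * V s) v := by
  have hmarg : ∀ k, HasSum (fun s => V s * (if M.aoai s = k then 1 else 0)) (p k) := fun k => by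
    obtain ⟨n, hn⟩ := hlaw k
    have hs : Summable fun s => V s * (if M.aoai s = k then (1 : ℝ) else 0) :=
      hV.summable_of_bounded (c := 1) fun s => by split_ifs <;> simp
    have hiter : ∀ n, HasSum (fun s => V s * M.expect l1 l2 n
        (fun u => if M.aoai u = k then 1 else 0) s)
        (∑' s, V s * (if M.aoai s = k then (1 : ℝ) else 0)) := fun n => by
      induction n with
      | zero => exact hs.hasSum
      | succ n ih => simp only [expect_succ]; exact hV.hasSum_transition h1 h2 ih
    have h3 := hiter n
    simp only [hn] at h3
    have h4 := hV.total.mul_right (p k)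
    rw [one_mul] at h4
    rw [h4.unique h3]
    exact hs.hasSum
  refine hasSum_of_fiberwise_nonneg
    (F := fun (k : ℕ) s => (k : ℝ) * (V s * (if M.aoai s = k then 1 else 0)))
    (fun k s => mul_nonneg (Nat.cast_nonneg k) (mul_nonneg (hV.nonneg s) (by positivity)))
    (fun k => (hmarg k).mul_left _) (fun s => ?_) hp
  have := hasSum_single (M.aoai s)
    (f := fun k : ℕ => (k : ℝ) * (V s * (if M.aoai s = k then 1 else 0)))
    (fun k hk => by simp [hk.symm])
  simpa using this

/-! ### Existence of stationary distributions -/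

open Classical in
/-- The transition operator of the chain killed when it enters the state `r`. -/
noncomputable def taboo (M : SlottedSystem S) (l1 l2 : ℝ) (r : S) (f : S → ℝ) : S → ℝ :=
  M.transition l1 l2 fun u => if u = r then 0 else f u

theorem taboo_sub (r : S) (f g : S → ℝ) (s : S) : M.taboo l1 l2 r (fun u => f u - g u) s
    = M.taboo l1 l2 r f s - M.taboo l1 l2 r g s := by
  rw [taboo, taboo, taboo, ← transition_sub]
  congr 1; funext u; split_ifs <;> simp

theorem taboo_le_taboo (h1 : l1 ∈ Set.Icc (0 : ℝ) 1) (h2 : l2 ∈ Set.Icc (0 : ℝ) 1) (r : S)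
    {f g : S → ℝ} (h : ∀ s, f s ≤ g s) (s : S) : M.taboo l1 l2 r f s ≤ M.taboo l1 l2 r g s :=
  transition_le_transition h1 h2 fun a b => by split_ifs <;> simp [h]

theorem taboo_iterate_nonneg (h1 : l1 ∈ Set.Icc (0 : ℝ) 1) (h2 : l2 ∈ Set.Icc (0 : ℝ) 1)
    (r : S) {f : S → ℝ} (h : ∀ s, 0 ≤ f s) (n : ℕ) (s : S) :
    0 ≤ (M.taboo l1 l2 r)^[n] f s := by
  induction n generalizing s with
  | zero => exact h s
  | succ n ih =>
    rw [Function.iterate_succ_apply']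
    exact transition_nonneg h1 h2 (fun u => by split_ifs <;> simp [ih]) s

theorem taboo_iterate_sub (r : S) (f g : S → ℝ) (n : ℕ) (s : S) :
    (M.taboo l1 l2 r)^[n] (fun u => f u - g u) s
      = (M.taboo l1 l2 r)^[n] f s - (M.taboo l1 l2 r)^[n] g s := by
  induction n generalizing f g with
  | zero => rfl
  | succ n ih =>
    simp only [Function.iterate_succ_apply]
    rw [show M.taboo l1 l2 r (fun u => f u - g u) = _ from funext (taboo_sub r f g), ih]

open Classical in
theorem hasSum_taboo_iterate (r : S) (f : S → ℝ) (n : ℕ) (s : S) :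
    HasSum (fun t => (M.taboo l1 l2 r)^[n] (fun u => if u = t then 1 else 0) s * f t)
      ((M.taboo l1 l2 r)^[n] f s) := by
  induction n generalizing s with
  | zero =>
    have := hasSum_single s (f := fun t => (if s = t then (1 : ℝ) else 0) * f t)
      (fun t ht => by simp [ht.symm])
    simpa using this
  | succ n ih =>
    simp only [Function.iterate_succ_apply']
    simp only [taboo, transition, Finset.sum_mul]
    refine hasSum_sum fun a _ => hasSum_sum fun b _ => ?_
    simp only [mul_assoc]
    refine HasSum.mul_left _ (HasSum.mul_left _ ?_)
    split_ifs
    · simp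
    · exact ih _

open Classical in
/-- A chain that returns to the state `r` in finite mean time, as certified by a function `W` that
decreases by one per slot on average until `r` is entered, has a stationary distribution: the mean
number of visits to a state before the return to `r`, divided by the mean return time. -/
theorem exists_isStationary (h1 : l1 ∈ Set.Icc (0 : ℝ) 1) (h2 : l2 ∈ Set.Icc (0 : ℝ) 1)
    (r : S) (W : S → ℝ) (hW : ∀ s, 0 ≤ W s) (h : ∀ s, M.taboo l1 l2 r W s + 1 ≤ W s) :
    ∃ V, M.IsStationary l1 l2 V := by
  set K := M.taboo l1 l2 r with hK
  set e : S → S → ℝ := fun t u => if u = t then 1 else 0 with he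
  have he0 : ∀ t u, 0 ≤ e t u := fun t u => by simp only [he]; split_ifs <;> simp
  have hsurv : Summable fun n => K^[n] (fun _ => 1) r := by
    refine summable_of_sum_range_le (c := W r)
      (fun n => taboo_iterate_nonneg h1 h2 r (fun _ => zero_le_one) n r) fun n => ?_
    have hstep : ∀ n s, K^[n + 1] W s + K^[n] (fun _ => 1) s ≤ K^[n] W s := fun n => by
      induction n with
      | zero => exact h
      | succ n ih =>
        intro s
        have h3 := taboo_le_taboo (M := M) h1 h2 r
          (f := K^[n] fun _ => 1) (g := fun u => K^[n] W u - K^[n + 1] W u)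
          (fun u => by linarith [ih u]) s
        rw [taboo_sub] at h3
        simp only [Function.iterate_succ_apply' K] at h3 ⊢
        linarith
    have htel : ∑ i ∈ Finset.range n, K^[i] (fun _ => 1) r + K^[n] W r ≤ W r := by
      induction n with
      | zero => simp
      | succ n ih => rw [Finset.sum_range_succ]; linarith [hstep n r]
    linarith [taboo_iterate_nonneg (M := M) h1 h2 r hW n r]
  set m := ∑' n, K^[n] (fun _ => 1) r with hm
  have hvis : ∀ n t, 0 ≤ K^[n] (e t) r := fun n t => taboo_iterate_nonneg h1 h2 r (he0 t) n r
  have hrow : ∀ n, HasSum (fun t => K^[n] (e t) r) (K^[n] (fun _ => 1) r) := fun n => by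
    simpa using hasSum_taboo_iterate (M := M) (l1 := l1) (l2 := l2) r (fun _ => 1) n r
  have hcol : ∀ t, Summable fun n => K^[n] (e t) r := fun t =>
    hsurv.of_nonneg_of_le (fun n => hvis n t) fun n => le_hasSum (hrow n) t fun u _ => hvis n u
  set G : S → ℝ := fun t => ∑' n, K^[n] (e t) r with hG
  have hGm : HasSum G m := hasSum_of_fiberwise_nonneg hvis hrow (fun t => (hcol t).hasSum)
    hsurv.hasSum
  have hm1 : 1 ≤ m := by
    simpa using hsurv.le_tsum 0
      fun n _ => taboo_iterate_nonneg (M := M) h1 h2 r (fun _ => zero_le_one) n r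
  -- The visits one slot later: a visit to `t ≠ r` is counted again, and the return to `r` happens
  -- exactly once.
  have hnext : ∀ t, HasSum (fun n => K^[n] (fun s => M.transitionProb l1 l2 s t) r) (G t) := by
    intro t
    by_cases ht : t = r
    · subst ht
      have hker : K (e t) = fun _ => 0 := by
        funext s
        refine Eq.trans ?_ (transition_const M (l1 := l1) (l2 := l2) 0 s)
        rw [hK, taboo]
        congr 1; funext u; simp only [he]; split_ifs <;> rfl
      have hzero : ∀ n, K^[n] (fun _ => (0 : ℝ)) = fun _ => 0 := fun n => by
        have := fun s => taboo_iterate_sub (M := M) (l1 := l1) (l2 := l2) t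
          (fun _ => 0) (fun _ => 0) n s
        funext s
        simpa using this s
      have hGt : G t = 1 := by
        rw [hG]
        refine (hasSum_single (f := fun n => K^[n] (e t) t) 0 fun n hn => ?_).tsum_eq.trans ?_
        · obtain ⟨n, rfl⟩ := Nat.exists_eq_succ_of_ne_zero hn
          rw [Function.iterate_succ_apply, hker, hzero]
        · simp [he]
      have hret : (fun s => M.transitionProb l1 l2 s t)
          = fun s => (fun _ => (1 : ℝ)) s - K (fun _ => 1) s := by
        funext s
        rw [hK, taboo, transitionProb]
        simp only
        rw [← transition_const M (l1 := l1) (l2 := l2) 1 s, ← transition_sub]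
        simp only [transition_const]
        congr 1; funext u; split_ifs <;> simp
      rw [hGt, hret]
      have hdiff : ∀ n, K^[n] (fun s => (fun _ => (1 : ℝ)) s - K (fun _ => 1) s) t
          = K^[n] (fun _ => 1) t - K^[n + 1] (fun _ => 1) t := fun n => by
        rw [taboo_iterate_sub, Function.iterate_succ_apply]
      simp only [hdiff]
      have := hsurv.hasSum.sub ((hasSum_nat_add_iff' 1).2 hsurv.hasSum)
      simpa using this
    · have hK' : (fun s => M.transitionProb l1 l2 s t) = K (e t) := by
        funext s
        rw [hK, taboo, transitionProb]
        congr 1; funext u; simp only [he]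
        by_cases hu : u = r
        · subst hu; simp [Ne.symm ht]
        · simp [hu]
      rw [hK']
      simp only [← Function.iterate_succ_apply]
      have := (hasSum_nat_add_iff' 1).2 (hcol t).hasSum
      simpa [he, Ne.symm ht] using this
  refine ⟨fun t => m⁻¹ * G t, fun t => mul_nonneg (by positivity) (tsum_nonneg fun n => hvis n t),
    ?_, fun t => ?_⟩
  · have := hGm.mul_left m⁻¹
    rwa [inv_mul_cancel₀ (by positivity)] at this
  · simp only [mul_assoc]
    refine HasSum.mul_left _ ?_
    refine hasSum_of_fiberwise_nonneg
      (F := fun n s => K^[n] (e s) r * M.transitionProb l1 l2 s t)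
      (fun n s => mul_nonneg (hvis n s) (transitionProb_nonneg h1 h2 s t))
      (fun n => hasSum_taboo_iterate r (fun s => M.transitionProb l1 l2 s t) n r)
      (fun s => (hcol s).hasSum.mul_right _) (hnext t)

end SlottedSystem

/-! ### Simulation of one system by another, and limits of the mean AoAI -/

namespace SlottedSystem

variable {S X : Type} {M : SlottedSystem S} {N : SlottedSystem X} {l1 l2 : ℝ}

/-- If a relation `R` between states at the same time is preserved by simultaneous steps with the
same inputs, then a comparison of `f` and `g` on related states holds for the means. -/
theorem expect_le_expect_of_simulation (h1 : l1 ∈ Set.Icc (0 : ℝ) 1)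
    (h2 : l2 ∈ Set.Icc (0 : ℝ) 1) {R : ℕ → S → X → Prop}
    (hstep : ∀ d s x a b, R d s x → R (d + 1) (M.step s a b) (N.step x a b))
    {f : S → ℝ} {g : X → ℝ} {n d : ℕ} {s : S} {x : X} (h : R d s x)
    (hfg : ∀ s x, R (d + n) s x → f s ≤ g x) : M.expect l1 l2 n f s ≤ N.expect l1 l2 n g x := by
  induction n generalizing d s x with
  | zero => exact hfg s x h
  | succ n ih =>
    rw [expect_succ, expect_succ]
    refine Finset.sum_le_sum fun a _ => Finset.sum_le_sum fun b _ =>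
      mul_le_mul_of_nonneg_left ?_ (mul_nonneg (bern_nonneg h1 a) (bern_nonneg h2 b))
    refine ih (hstep d s x a b h) fun s x hR => hfg s x ?_
    rwa [add_assoc, add_comm 1 n] at hR

theorem expect_eq_expect_of_simulation {R : ℕ → S → X → Prop}
    (hstep : ∀ d s x a b, R d s x → R (d + 1) (M.step s a b) (N.step x a b))
    {f : S → ℝ} {g : X → ℝ} {n d : ℕ} {s : S} {x : X} (h : R d s x)
    (hfg : ∀ s x, R (d + n) s x → f s = g x) : M.expect l1 l2 n f s = N.expect l1 l2 n g x := by
  induction n generalizing d s x with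
  | zero => exact hfg s x h
  | succ n ih =>
    rw [expect_succ, expect_succ]
    refine Finset.sum_congr rfl fun a _ => Finset.sum_congr rfl fun b _ => ?_
    rw [ih (hstep d s x a b h) fun s x hR => hfg s x (by rwa [add_assoc, add_comm 1 n] at hR)]

/-- A distribution on `ℕ` with a finite mean has tails `o(1 / n)`. -/
theorem tendsto_mul_one_sub_sum {p : ℕ → ℝ} {v : ℝ} (hp0 : ∀ k, 0 ≤ p k) (hp : HasSum p 1)
    (hv : HasSum (fun k : ℕ => (k : ℝ) * p k) v) :
    Tendsto (fun n : ℕ => (n : ℝ) * (1 - ∑ k ∈ Finset.range n, p k)) atTop (𝓝 0) := by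
  have hv' : Tendsto (fun n : ℕ => v - ∑ k ∈ Finset.range n, (k : ℝ) * p k) atTop (𝓝 0) := by
    simpa using hv.tendsto_sum_nat.const_sub v
  refine squeeze_zero (fun n => ?_) (fun n => ?_) hv'
  · exact mul_nonneg n.cast_nonneg
      (sub_nonneg.2 (sum_le_hasSum _ (fun k _ => hp0 k) hp))
  · have ht := (hasSum_nat_add_iff' n).2 hp
    have hvt := (hasSum_nat_add_iff' n).2 hv
    refine hasSum_le (fun k => ?_) (ht.mul_left (n : ℝ)) hvt
    exact mul_le_mul_of_nonneg_right (by push_cast; linarith [k.cast_nonneg (α := ℝ)]) (hp0 _)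

/-- If the AoAI has, as soon as more than `k` slots have elapsed, exactly the probability `p k` of
being `k`, then the mean AoAI converges to the mean of `p`: the AoAI grows by at most one per slot,
so that the contribution of the event that it is at least `n` at time `n` is bounded by the tail of
the mean of `p`. -/
theorem hasLimitingAverage_of_law (h1 : l1 ∈ Set.Icc (0 : ℝ) 1) (h2 : l2 ∈ Set.Icc (0 : ℝ) 1)
    {p : ℕ → ℝ} {v : ℝ} (hp0 : ∀ k, 0 ≤ p k) (hp : HasSum p 1)
    (hv : HasSum (fun k : ℕ => (k : ℝ) * p k) v)
    (hgrow : ∀ s a b, M.aoai (M.step s a b) ≤ M.aoai s + 1)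
    (hlaw : ∀ k n s, k < n →
      M.expect l1 l2 n (fun u => if M.aoai u = k then 1 else 0) s = p k) :
    M.HasLimitingAverage l1 l2 v := by
  refine ⟨⟨p, hp0, hp, hv, fun s k => ?_⟩, fun s => ?_⟩
  · refine tendsto_const_nhds.congr' ?_
    filter_upwards [eventually_gt_atTop k] with n hn
    exact (hlaw k n s hn).symm
  · have hR : ∀ (d : ℕ) (u w : S) (a b : Bool), (u = w ∧ M.aoai u ≤ M.aoai s + d) →
        (M.step u a b = M.step w a b ∧ M.aoai (M.step u a b) ≤ M.aoai s + (d + 1)) :=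
      fun d u w a b ⟨h3, h4⟩ => ⟨by rw [h3], (hgrow u a b).trans (by omega)⟩
    have hind : ∀ (n : ℕ) (φ : ℕ → ℝ) (u : S),
        ∑ k ∈ Finset.range n, φ k * (if M.aoai u = k then (1 : ℝ) else 0)
          = if M.aoai u < n then φ (M.aoai u) else 0 := fun n φ u => by
      simp
    have hmean : ∀ (φ : ℕ → ℝ) (n : ℕ), M.expect l1 l2 n (fun u => ∑ k ∈ Finset.range n,
        φ k * (if M.aoai u = k then (1 : ℝ) else 0)) s
        = ∑ k ∈ Finset.range n, φ k * p k := fun φ n => by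
      rw [expect_sum]
      refine Finset.sum_congr rfl fun k hk => ?_
      rw [expect_mul_left, hlaw k n s (Finset.mem_range.1 hk)]
    have hlow : ∀ n, ∑ k ∈ Finset.range n, (k : ℝ) * p k
        ≤ M.expect l1 l2 n (fun u => (M.aoai u : ℝ)) s := fun n => by
      rw [← hmean (fun k => (k : ℝ))]
      refine expect_le_expect_of_simulation h1 h2 (d := 0)
        (R := fun d u w => u = w ∧ M.aoai u ≤ M.aoai s + d) hR ⟨rfl, le_rfl⟩ ?_
      rintro u w ⟨rfl, -⟩
      rw [hind]
      split_ifs <;> simp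
    have hup : ∀ n, M.expect l1 l2 n (fun u => (M.aoai u : ℝ)) s
        ≤ ∑ k ∈ Finset.range n, (k : ℝ) * p k
          + (M.aoai s + n) * (1 - ∑ k ∈ Finset.range n, p k) := fun n => by
      have hrhs : M.expect l1 l2 n (fun u => (∑ k ∈ Finset.range n,
          (k : ℝ) * (if M.aoai u = k then (1 : ℝ) else 0)) + (M.aoai s + n) * (1 + (-1) *
          ∑ k ∈ Finset.range n, (1 : ℝ) * (if M.aoai u = k then (1 : ℝ) else 0))) s
          = ∑ k ∈ Finset.range n, (k : ℝ) * p k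
            + (M.aoai s + n) * (1 - ∑ k ∈ Finset.range n, p k) := by
        rw [expect_add, hmean (fun k => (k : ℝ)), expect_mul_left, expect_add, expect_const,
          expect_mul_left, hmean (fun _ => 1)]
        simp only [one_mul]; ring
      rw [← hrhs]
      refine expect_le_expect_of_simulation h1 h2 (d := 0)
        (R := fun d u w => u = w ∧ M.aoai u ≤ M.aoai s + d) hR ⟨rfl, le_rfl⟩ ?_
      rintro u w ⟨rfl, hu⟩
      rw [hind n (fun k => (k : ℝ)), hind n (fun _ => 1)]
      rw [zero_add] at hu
      have hu' : (M.aoai u : ℝ) ≤ M.aoai s + n := by exact_mod_cast hu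
      split_ifs <;> linarith
    have htail : Tendsto (fun n : ℕ => (M.aoai s + n : ℝ) * (1 - ∑ k ∈ Finset.range n, p k))
        atTop (𝓝 0) := by
      have h3 : Tendsto (fun n : ℕ => (M.aoai s : ℝ) * (1 - ∑ k ∈ Finset.range n, p k))
          atTop (𝓝 0) := by
        simpa using (hp.tendsto_sum_nat.const_sub 1).const_mul (M.aoai s : ℝ)
      simpa [add_mul] using h3.add (tendsto_mul_one_sub_sum hp0 hp hv)
    refine tendsto_of_tendsto_of_tendsto_of_le_of_le hv.tendsto_sum_nat ?_ hlow hup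
    simpa using hv.tendsto_sum_nat.add htail

end SlottedSystem

/-! ### The law of the AoAI when the freshest packet is actuated -/

/-- The pair `(AoAI, freshest age)` of a system that actuates the freshest packet, where the second
component is the AoAI that would result if the freshest packet (stored or already actuated) had been
actuated. An arrival resets the second component to `1`; a permission copies it to the first. -/
def freshest : SlottedSystem (ℕ × ℕ) where
  step x arrival perm :=
    (if perm then (if arrival then 1 else x.2 + 1) else x.1 + 1, if arrival then 1 else x.2 + 1)
  aoai := Prod.fst

/-- The law of `1 + i + j` for independent numbers `i`, `j` of failures before the first success in
Bernoulli trials with parameters `l2` and `l1`: the time since the last permission, and the time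
between that permission and the last arrival before it. -/
noncomputable def freshestLaw (l1 l2 : ℝ) : ℕ → ℝ
  | 0 => 0
  | k + 1 => ∑ ij ∈ Finset.HasAntidiagonal.antidiagonal k,
      (l2 * (1 - l2) ^ ij.1) * (l1 * (1 - l1) ^ ij.2)

/-- The mean of `ψ` at the freshest age after `m` slots, if that age is now `f`. -/
noncomputable def freshestAgeMean (l1 : ℝ) (m : ℕ) (ψ : ℕ → ℝ) (f : ℕ) : ℝ :=
  ∑ j ∈ Finset.range m, l1 * (1 - l1) ^ j * ψ (j + 1) + (1 - l1) ^ m * ψ (f + m)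

theorem freshestAgeMean_succ (l1 : ℝ) (m : ℕ) (ψ : ℕ → ℝ) (f : ℕ) :
    l1 * freshestAgeMean l1 m ψ 1 + (1 - l1) * freshestAgeMean l1 m ψ (f + 1)
      = freshestAgeMean l1 (m + 1) ψ f := by
  simp only [freshestAgeMean, Finset.sum_range_succ]
  rw [add_comm 1 m, add_assoc f 1 m, add_comm 1 m]
  ring

/-- The law of the first component, by conditioning on the number `i` of slots since the last
permission. -/
theorem freshest_expect (l1 l2 : ℝ) (φ : ℕ → ℝ) (n : ℕ) (x : ℕ × ℕ) :
    freshest.expect l1 l2 n (fun u => φ u.1) x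
      = ∑ i ∈ Finset.range n,
          l2 * (1 - l2) ^ i * freshestAgeMean l1 (n - i) (fun j => φ (j + i)) x.2
        + (1 - l2) ^ n * φ (x.1 + n) := by
  induction n generalizing x with
  | zero => simp [SlottedSystem.expect_zero]
  | succ n ih =>
    have hsum : ∑ i ∈ Finset.range n,
        l2 * (1 - l2) ^ i * freshestAgeMean l1 (n + 1 - i) (fun j => φ (j + i)) x.2
        = l1 * ∑ i ∈ Finset.range n,
            l2 * (1 - l2) ^ i * freshestAgeMean l1 (n - i) (fun j => φ (j + i)) 1
          + (1 - l1) * ∑ i ∈ Finset.range n,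
            l2 * (1 - l2) ^ i * freshestAgeMean l1 (n - i) (fun j => φ (j + i)) (x.2 + 1) := by
      rw [Finset.mul_sum, Finset.mul_sum, ← Finset.sum_add_distrib]
      refine Finset.sum_congr rfl fun i hi => ?_
      rw [Nat.sub_add_comm (Finset.mem_range.1 hi).le, ← freshestAgeMean_succ]
      ring
    have hlast : freshestAgeMean l1 (n + 1 - n) (fun j => φ (j + n)) x.2
        = l1 * φ (1 + n) + (1 - l1) * φ (x.2 + 1 + n) := by
      simp [freshestAgeMean]
    rw [SlottedSystem.expect_succ, SlottedSystem.transition_apply, Finset.sum_range_succ, hsum,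
      hlast]
    simp only [ih]
    simp only [freshest, if_true, Bool.false_eq_true, if_false]
    rw [show x.1 + (n + 1) = x.1 + 1 + n by ring]
    ring

/-- At time `n`, the AoAI of the chain started in `(0, 0)` has the limiting probability of being `k`
exactly, for every `k < n`: such a value is determined by the slots `1, …, n`. -/
theorem freshest_law (l1 l2 : ℝ) {k n : ℕ} (hk : k < n) :
    freshest.expect l1 l2 n (fun u => if u.1 = k then 1 else 0) (0, 0) = freshestLaw l1 l2 k := by
  rw [freshest_expect l1 l2 (fun a => if a = k then 1 else 0)]
  have hinner : ∀ i ∈ Finset.range n,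
      l2 * (1 - l2) ^ i * freshestAgeMean l1 (n - i) (fun j => if j + i = k then 1 else 0) 0
      = if i < k then l2 * (1 - l2) ^ i * (l1 * (1 - l1) ^ (k - 1 - i)) else 0 := fun i hi => by
    have hi := Finset.mem_range.1 hi
    rw [freshestAgeMean, if_neg (by omega), mul_zero, add_zero]
    split_ifs with hik
    · rw [Finset.sum_eq_single (k - 1 - i), if_pos (by omega), mul_one]
      · intro j _ hj
        rw [if_neg (by omega), mul_zero]
      · intro h
        exact absurd (Finset.mem_range.2 (by omega)) h
    · rw [Finset.sum_eq_zero, mul_zero]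
      intro j _
      rw [if_neg (by omega), mul_zero]
  rw [Finset.sum_congr rfl hinner, if_neg (by omega), mul_zero, add_zero, ← Finset.sum_filter]
  have hrange : (Finset.range n).filter (· < k) = Finset.range k := by
    ext i; simp only [Finset.mem_filter, Finset.mem_range]; omega
  rw [hrange]
  cases k with
  | zero => simp [freshestLaw]
  | succ k =>
    rw [freshestLaw, Finset.Nat.sum_antidiagonal_eq_sum_range_succ
      (fun i j => (l2 * (1 - l2) ^ i) * (l1 * (1 - l1) ^ j))]
    rfl

theorem hasSum_antidiagonal {F : ℕ × ℕ → ℝ} {m : ℝ} (h : HasSum F m) :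
    HasSum (fun n => ∑ ij ∈ Finset.HasAntidiagonal.antidiagonal n, F ij) m :=
  (Finset.HasAntidiagonal.sigmaAntidiagonalEquivProd.hasSum_iff.2 h).sigma
    fun n => (Finset.HasAntidiagonal.antidiagonal n).hasSum F

theorem freshestLaw_hasSum {l1 l2 : ℝ} (hl1 : 0 < l1) (hl1' : l1 ≤ 1) (hl2 : 0 < l2)
    (hl2' : l2 ≤ 1) : HasSum (freshestLaw l1 l2) 1 ∧
      HasSum (fun k : ℕ => (k : ℝ) * freshestLaw l1 l2 k) (1 / l1 + 1 / l2 - 1) := by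
  have hgeo : ∀ p : ℝ, 0 < p → p ≤ 1 → HasSum (fun i : ℕ => p * (1 - p) ^ i) 1 ∧
      HasSum (fun i : ℕ => (i : ℝ) * (p * (1 - p) ^ i)) (1 / p - 1) := fun p h0 h1 => by
    have hlt : ‖1 - p‖ < 1 := by
      rw [Real.norm_eq_abs, abs_of_nonneg (by linarith)]; linarith
    constructor
    · have := (hasSum_geometric_of_lt_one (r := 1 - p) (by linarith) (by linarith)).mul_left p
      rwa [sub_sub_cancel, mul_inv_cancel₀ h0.ne'] at this
    · have := (hasSum_coe_mul_geometric_of_norm_lt_one hlt).mul_left p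
      rw [sub_sub_cancel, show p * ((1 - p) / p ^ 2) = 1 / p - 1 by field_simp] at this
      refine this.congr_fun fun i => ?_
      ring
  obtain ⟨hc, hc'⟩ := hgeo l2 hl2 hl2'
  obtain ⟨hd, hd'⟩ := hgeo l1 hl1 hl1'
  have hc0 : ∀ i, 0 ≤ l2 * (1 - l2) ^ i := fun i =>
    mul_nonneg hl2.le (pow_nonneg (by linarith) i)
  have hd0 : ∀ i, 0 ≤ l1 * (1 - l1) ^ i := fun i =>
    mul_nonneg hl1.le (pow_nonneg (by linarith) i)
  have hmul : ∀ {f g : ℕ → ℝ} {a b : ℝ}, (∀ i, 0 ≤ f i) → (∀ i, 0 ≤ g i) → HasSum f a →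
      HasSum g b → HasSum (fun ij : ℕ × ℕ => f ij.1 * g ij.2) (a * b) :=
    fun hf0 hg0 hf hg => hf.mul hg (hf.summable.mul_of_nonneg hg.summable hf0 hg0)
  have hcd := hmul hc0 hd0 hc hd
  have hcd1 := hmul (fun i => mul_nonneg i.cast_nonneg (hc0 i)) hd0 hc' hd
  have hcd2 := hmul hc0 (fun i => mul_nonneg i.cast_nonneg (hd0 i)) hc hd'
  constructor
  · rw [← hasSum_nat_add_iff' 1]
    simpa [freshestLaw] using hasSum_antidiagonal hcd
  · rw [← hasSum_nat_add_iff' 1]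
    have h3 := hasSum_antidiagonal ((hcd1.add hcd2).add hcd)
    have hval : (1 / l2 - 1) * 1 + 1 * (1 / l1 - 1) + 1 * 1 = 1 / l1 + 1 / l2 - 1 := by ring
    rw [hval] at h3
    have hzero : ∑ i ∈ Finset.range 1, (i : ℝ) * freshestLaw l1 l2 i = 0 := by simp
    rw [hzero, sub_zero]
    refine h3.congr_fun fun k => ?_
    rw [freshestLaw, Finset.mul_sum]
    refine Finset.sum_congr rfl fun ij hij => ?_
    rw [← Finset.HasAntidiagonal.mem_antidiagonal.1 hij]
    push_cast
    ring

theorem freshestLaw_nonneg {l1 l2 : ℝ} (h1 : l1 ∈ Set.Icc (0 : ℝ) 1)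
    (h2 : l2 ∈ Set.Icc (0 : ℝ) 1) (k : ℕ) : 0 ≤ freshestLaw l1 l2 k := by
  cases k with
  | zero => exact le_rfl
  | succ k =>
    exact Finset.sum_nonneg fun ij _ => mul_nonneg
      (mul_nonneg h2.1 (pow_nonneg (sub_nonneg.2 h2.2) _))
      (mul_nonneg h1.1 (pow_nonneg (sub_nonneg.2 h1.2) _))

/-! ### LCFS and the single-packet buffer -/

/-- The state `x` of the chain `freshest`, started `d` slots ago in `(0, 0)`, describes the LCFS
state `s`, if every age is truncated at `d`. The truncation makes all packets that were in the
system initially equally old, so that the truncated queue is sorted whatever the initial state. -/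
def LcfsTracks (d : ℕ) (s : QueueState) (x : ℕ × ℕ) : Prop :=
  x.1 = min s.ai d ∧ x.2 = min (min (s.queue.headD s.ai) s.ai) d ∧
    s.queue.Pairwise fun p q => min p d ≤ q

theorem LcfsTracks.step {d : ℕ} {s : QueueState} {x : ℕ × ℕ} (a b : Bool)
    (h : LcfsTracks d s x) : LcfsTracks (d + 1) (lcfs.step s a b) (freshest.step x a b) := by
  obtain ⟨ai, q⟩ := s
  obtain ⟨x1, x2⟩ := x
  obtain ⟨h1, h2, h3⟩ := h
  simp only at h1 h2 h3
  have hmap : (q.map (· + 1)).Pairwise fun p r => min p (d + 1) ≤ r := by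
    rw [List.pairwise_map]
    exact h3.imp fun h => by omega
  cases q with
  | nil =>
    simp only [List.headD_nil] at h2
    cases a <;> cases b <;>
      simp [LcfsTracks, lcfs, freshest, actuateQueue] <;> omega
  | cons p q =>
    simp only [List.headD_cons] at h2
    rw [List.pairwise_cons] at h3
    simp only [List.map_cons, List.pairwise_cons] at hmap
    cases a <;> cases b <;>
      simp only [LcfsTracks, lcfs, freshest, actuateQueue, if_true, Bool.false_eq_true, if_false,
        List.nil_append, List.cons_append, List.map_cons, List.headD_cons, List.pairwise_cons]
    · exact ⟨by omega, by omega, hmap⟩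
    · refine ⟨by omega, ?_, hmap.2⟩
      cases q with
      | nil => simp; omega
      | cons r q =>
        have := h3.1 r (by simp)
        simp only [List.map_cons, List.headD_cons]
        omega
    · refine ⟨by omega, by omega, fun r hr => ?_, hmap⟩
      rcases List.mem_cons.1 hr with rfl | hr
      · omega
      · obtain ⟨t, -, rfl⟩ := List.mem_map.1 hr
        omega
    · exact ⟨by omega, by omega, hmap⟩

/-- The analogue of `LcfsTracks` for a single-packet buffer. -/
def SingleBufferTracks (d : ℕ) (s : BufferState) (x : ℕ × ℕ) : Prop :=
  x.1 = min s.ai d ∧ x.2 = min (min (s.buffer.getD s.ai) s.ai) d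

theorem SingleBufferTracks.step {d : ℕ} {s : BufferState} {x : ℕ × ℕ} (a b : Bool)
    (h : SingleBufferTracks d s x) :
    SingleBufferTracks (d + 1) (singleBuffer.step s a b) (freshest.step x a b) := by
  obtain ⟨ai, q⟩ := s
  obtain ⟨x1, x2⟩ := x
  obtain ⟨h1, h2⟩ := h
  cases q <;> cases a <;> cases b <;>
    simp [SingleBufferTracks, singleBuffer, freshest, refresh] at h1 h2 ⊢ <;> omega

/-- The AoAI of a system that tracks `freshest` equals that of `freshest` as long as it is smaller
than the number of elapsed slots. -/
theorem law_of_tracks {S : Type} {M : SlottedSystem S} {R : ℕ → S → ℕ × ℕ → Prop} (l1 l2 : ℝ)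
    (hR0 : ∀ s, R 0 s (0, 0))
    (hstep : ∀ d s x a b, R d s x → R (d + 1) (M.step s a b) (freshest.step x a b))
    (hR : ∀ d s x, R d s x → x.1 = min (M.aoai s) d) {k n : ℕ} (s : S) (hk : k < n) :
    M.expect l1 l2 n (fun u => if M.aoai u = k then 1 else 0) s = freshestLaw l1 l2 k := by
  rw [← freshest_law l1 l2 hk]
  refine SlottedSystem.expect_eq_expect_of_simulation hstep (hR0 s) fun u x hx => ?_
  have hx1 := hR _ _ _ hx
  rw [zero_add] at hx1
  refine if_congr ?_ rfl rfl
  omega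

theorem lcfs_law (l1 l2 : ℝ) {k n : ℕ} (s : QueueState) (hk : k < n) :
    lcfs.expect l1 l2 n (fun u => if lcfs.aoai u = k then 1 else 0) s = freshestLaw l1 l2 k :=
  law_of_tracks l1 l2 (R := LcfsTracks)
    (fun s => ⟨by simp, by simp, List.pairwise_of_forall (by simp)⟩)
    (fun _ _ _ a b h => h.step a b) (fun _ _ _ h => h.1) s hk

theorem singleBuffer_law (l1 l2 : ℝ) {k n : ℕ} (s : BufferState) (hk : k < n) :
    singleBuffer.expect l1 l2 n (fun u => if singleBuffer.aoai u = k then 1 else 0) s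
      = freshestLaw l1 l2 k :=
  law_of_tracks l1 l2 (R := SingleBufferTracks) (fun s => ⟨by simp, by simp⟩)
    (fun _ _ _ a b h => h.step a b) (fun _ _ _ h => h.1) s hk

theorem actuateQueue_ai_le (ai : ℕ) (q : List ℕ) (b : Bool) :
    (actuateQueue ai q b).ai ≤ ai + 1 := by
  cases b <;> cases q <;> simp [actuateQueue]

theorem lcfs_hasLimitingAverage {l1 l2 : ℝ} (hl1 : 0 < l1) (hl1' : l1 ≤ 1) (hl2 : 0 < l2)
    (hl2' : l2 ≤ 1) : lcfs.HasLimitingAverage l1 l2 (1 / l1 + 1 / l2 - 1) :=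
  SlottedSystem.hasLimitingAverage_of_law ⟨hl1.le, hl1'⟩ ⟨hl2.le, hl2'⟩
    (freshestLaw_nonneg ⟨hl1.le, hl1'⟩ ⟨hl2.le, hl2'⟩)
    (freshestLaw_hasSum hl1 hl1' hl2 hl2').1 (freshestLaw_hasSum hl1 hl1' hl2 hl2').2
    (fun s _ b => actuateQueue_ai_le s.ai _ b) fun _ _ s hk => lcfs_law l1 l2 s hk

/-- A queue whose length changes as in a Geo/Geo/1 queue, and which returns to the same state `r`
whenever a packet that arrives to the empty queue is actuated at once, has a stationary
distribution if `l1 < l2`: the queue length has drift `l1 - l2` while it is positive. -/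
theorem exists_isStationary_of_queue {M : SlottedSystem QueueState} {r : QueueState} {l1 l2 : ℝ}
    (hl1 : 0 < l1) (hl2' : l2 ≤ 1) (hlt : l1 < l2)
    (hr : ∀ ai, M.step ⟨ai, []⟩ true true = r)
    (hlen : ∀ s a b, (M.step s a b).queue.length
      = s.queue.length + (if a then 1 else 0) - (if b then 1 else 0)) :
    ∃ V, M.IsStationary l1 l2 V := by
  classical
  have h1 : l1 ∈ Set.Icc (0 : ℝ) 1 := ⟨hl1.le, by linarith⟩
  have h2 : l2 ∈ Set.Icc (0 : ℝ) 1 := ⟨by linarith, hl2'⟩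
  set α := (l2 - l1)⁻¹ with hα
  have hα0 : 0 < α := inv_pos.2 (by linarith)
  have hα1 : α * (l2 - l1) = 1 := inv_mul_cancel₀ (by linarith)
  set β := (1 + l1 * (1 - l2) * α) / (l1 * l2) with hβ
  have hβ1 : l1 * l2 * β = 1 + l1 * (1 - l2) * α := by
    have : l1 * l2 ≠ 0 := mul_ne_zero hl1.ne' (by linarith)
    rw [hβ, mul_div_cancel₀ _ this]
  have hβ0 : 0 ≤ β := div_nonneg
    (add_nonneg zero_le_one (mul_nonneg (mul_nonneg hl1.le (by linarith)) hα0.le))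
    (mul_nonneg hl1.le (by linarith))
  set W : QueueState → ℝ := fun s => α * s.queue.length + β with hW
  have hW0 : ∀ s, 0 ≤ W s := fun s => by positivity
  refine SlottedSystem.exists_isStationary h1 h2 r W hW0 fun s => ?_
  obtain ⟨ai, q⟩ := s
  cases q with
  | nil =>
    have hle : ∀ u, (if u = r then 0 else W u) ≤ W u := fun u => by split_ifs <;> simp [hW0]
    have h3 := mul_le_mul_of_nonneg_left (hle (M.step ⟨ai, []⟩ true false))
      (mul_nonneg hl1.le (sub_nonneg.2 hl2'))
    have h4 := mul_le_mul_of_nonneg_left (hle (M.step ⟨ai, []⟩ false true))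
      (mul_nonneg (sub_nonneg.2 h1.2) h2.1)
    have h5 := mul_le_mul_of_nonneg_left (hle (M.step ⟨ai, []⟩ false false))
      (mul_nonneg (sub_nonneg.2 h1.2) (sub_nonneg.2 hl2'))
    rw [SlottedSystem.taboo, SlottedSystem.transition_apply, hr, if_pos rfl]
    simp only [hW, hlen] at h3 h4 h5 ⊢
    simp at h3 h4 h5 ⊢
    nlinarith
  | cons p q =>
    have h3 : M.taboo l1 l2 r W ⟨ai, p :: q⟩ ≤ M.transition l1 l2 W ⟨ai, p :: q⟩ :=
      SlottedSystem.transition_le_transition h1 h2 fun a b => by split_ifs <;> simp [hW0]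
    have h4 : M.transition l1 l2 W ⟨ai, p :: q⟩ + 1 = W ⟨ai, p :: q⟩ := by
      rw [SlottedSystem.transition_apply]
      simp only [hW, hlen]
      simp
      linear_combination (-1 : ℝ) * hα1
    linarith

theorem actuateQueue_length (ai : ℕ) (q : List ℕ) (b : Bool) :
    (actuateQueue ai q b).queue.length = q.length - (if b then 1 else 0) := by
  cases b <;> cases q <;> simp [actuateQueue]

theorem lcfs_hasStationaryAverage {l1 l2 : ℝ} (hl1 : 0 < l1) (hl2' : l2 ≤ 1) (hlt : l1 < l2) :
    lcfs.HasStationaryAverage l1 l2 (1 / l1 + 1 / l2 - 1) := by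
  have h1 : l1 ∈ Set.Icc (0 : ℝ) 1 := ⟨hl1.le, by linarith⟩
  have h2 : l2 ∈ Set.Icc (0 : ℝ) 1 := ⟨by linarith, hl2'⟩
  refine ⟨exists_isStationary_of_queue (r := ⟨1, []⟩) hl1 hl2' hlt (fun ai => ?_)
    (fun s a b => ?_), fun V hV => hV.hasSum_aoai_of_law h1 h2
      (freshestLaw_hasSum hl1 h1.2 (by linarith) hl2').2
      fun k => ⟨k + 1, fun s => lcfs_law l1 l2 s k.lt_succ_self⟩⟩
  · simp [lcfs, actuateQueue]
  · rw [lcfs, actuateQueue_length]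
    cases a <;> simp

/-- An arrival together with a permission leads to the same state from every state, so the return
time to that state is geometric. -/
theorem singleBuffer_hasStationaryAverage {l1 l2 : ℝ} (hl1 : 0 < l1) (hl1' : l1 ≤ 1)
    (hl2 : 0 < l2) (hl2' : l2 ≤ 1) :
    singleBuffer.HasStationaryAverage l1 l2 (1 / l1 + 1 / l2 - 1) := by
  classical
  have h1 : l1 ∈ Set.Icc (0 : ℝ) 1 := ⟨hl1.le, hl1'⟩
  have h2 : l2 ∈ Set.Icc (0 : ℝ) 1 := ⟨hl2.le, hl2'⟩
  refine ⟨SlottedSystem.exists_isStationary h1 h2 ⟨1, none⟩ (fun _ => (l1 * l2)⁻¹)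
    (fun _ => by positivity) fun s => ?_, fun V hV => hV.hasSum_aoai_of_law h1 h2
      (freshestLaw_hasSum hl1 hl1' hl2 hl2').2
      fun k => ⟨k + 1, fun s => singleBuffer_law l1 l2 s k.lt_succ_self⟩⟩
  have hreset : singleBuffer.step s true true = ⟨1, none⟩ := by
    simp [singleBuffer, refresh]
  have hle : ∀ u : BufferState, (if u = ⟨1, none⟩ then 0 else (l1 * l2)⁻¹) ≤ (l1 * l2)⁻¹ :=
    fun u => by split_ifs <;> first | exact le_rfl | positivity
  rw [SlottedSystem.taboo, SlottedSystem.transition_apply, hreset, if_pos rfl]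
  have h4 := mul_le_mul_of_nonneg_left (hle (singleBuffer.step s true false))
    (mul_nonneg hl1.le (sub_nonneg.2 hl2'))
  have h5 := mul_le_mul_of_nonneg_left (hle (singleBuffer.step s false true))
    (mul_nonneg (sub_nonneg.2 hl1') hl2.le)
  have h6 := mul_le_mul_of_nonneg_left (hle (singleBuffer.step s false false))
    (mul_nonneg (sub_nonneg.2 hl1') (sub_nonneg.2 hl2'))
  have h7 : l1 * l2 * (l1 * l2)⁻¹ = 1 := mul_inv_cancel₀ (by positivity)
  linarith

/-! ### FCFS -/

/-- The sum of the running minima `e₀ = ai`, `eᵢ₊₁ = min eᵢ pᵢ₊₁` along the queue `p₁, p₂, …`; these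
are the successive values to which actuations of the queued packets would bring the AoAI if ages did
not grow. For a queue that is sorted by age they are the ages themselves. -/
def minimaSum : ℕ → List ℕ → ℕ
  | ai, [] => ai
  | ai, p :: q => ai + minimaSum (min ai p) q

/-- The last running minimum along the queue: the least of the AoAI and the ages in the queue. -/
def minimaLast : ℕ → List ℕ → ℕ
  | ai, [] => ai
  | ai, p :: q => minimaLast (min ai p) q

theorem minimaSum_succ (ai : ℕ) (q : List ℕ) :
    minimaSum (ai + 1) (q.map (· + 1)) = minimaSum ai q + q.length + 1 := by
  induction q generalizing ai with
  | nil => rfl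
  | cons p q ih =>
    simp only [List.map_cons, minimaSum, List.length_cons]
    rw [show min (ai + 1) (p + 1) = min ai p + 1 by omega, ih]
    omega

theorem minimaLast_succ (ai : ℕ) (q : List ℕ) :
    minimaLast (ai + 1) (q.map (· + 1)) = minimaLast ai q + 1 := by
  induction q generalizing ai with
  | nil => rfl
  | cons p q ih =>
    simp only [List.map_cons, minimaLast]
    rw [show min (ai + 1) (p + 1) = min ai p + 1 by omega, ih]

theorem minimaSum_append_one (ai : ℕ) (q : List ℕ) :
    minimaSum (ai + 1) (q.map (· + 1) ++ [1]) = minimaSum ai q + q.length + 2 := by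
  induction q generalizing ai with
  | nil => simp [minimaSum]
  | cons p q ih =>
    simp only [List.map_cons, List.cons_append, minimaSum, List.length_cons]
    rw [show min (ai + 1) (p + 1) = min ai p + 1 by omega, ih]
    omega

theorem minimaLast_append_one (ai : ℕ) (q : List ℕ) :
    minimaLast (ai + 1) (q.map (· + 1) ++ [1]) = 1 := by
  induction q generalizing ai with
  | nil => simp [minimaLast]
  | cons p q ih =>
    simp only [List.map_cons, List.cons_append, minimaLast]
    rw [show min (ai + 1) (p + 1) = min ai p + 1 by omega, ih]

theorem minimaSum_le (ai : ℕ) (q : List ℕ) : minimaSum ai q ≤ (q.length + 1) * ai := by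
  induction q generalizing ai with
  | nil => simp [minimaSum]
  | cons p q ih =>
    rw [minimaSum, List.length_cons, Nat.add_mul _ 1 ai, one_mul, add_comm]
    exact Nat.add_le_add_right
      ((ih _).trans (Nat.mul_le_mul_left _ (min_le_left _ _))) ai

theorem minimaLast_le (ai : ℕ) (q : List ℕ) : minimaLast ai q ≤ ai := by
  induction q generalizing ai with
  | nil => exact le_rfl
  | cons p q ih => exact (ih _).trans (min_le_left _ _)

/-- One slot of FCFS in which the queue is not empty before the actuation decision: the running
minima grow by one, an arrival appends the minimum `1`, and a permission removes the first minimum,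
which is the AoAI. -/
theorem fcfs_step_minima (ai : ℕ) (q : List ℕ) (a b : Bool) (h : q ≠ [] ∨ a = true) :
    minimaSum (fcfs.step ⟨ai, q⟩ a b).ai (fcfs.step ⟨ai, q⟩ a b).queue + (if b then ai + 1 else 0)
        = minimaSum ai q + q.length + 1 + (if a then 1 else 0) ∧
      minimaLast (fcfs.step ⟨ai, q⟩ a b).ai (fcfs.step ⟨ai, q⟩ a b).queue
        = if a then 1 else minimaLast ai q + 1 := by
  have hact : ∀ Q : List ℕ, Q ≠ [] → ∀ b, minimaSum (actuateQueue ai Q b).ai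
      (actuateQueue ai Q b).queue + (if b then ai + 1 else 0) = minimaSum (ai + 1) Q ∧
      minimaLast (actuateQueue ai Q b).ai (actuateQueue ai Q b).queue = minimaLast (ai + 1) Q := by
    intro Q hQ b
    cases Q with
    | nil => exact absurd rfl hQ
    | cons p Q => cases b <;> simp [actuateQueue, minimaSum, minimaLast, add_comm]
  cases a with
  | true =>
    obtain ⟨h1, h2⟩ := hact (q.map (· + 1) ++ [1]) (by simp) b
    exact ⟨h1.trans (minimaSum_append_one ai q), h2.trans (minimaLast_append_one ai q)⟩
  | false =>
    have hq : q ≠ [] := by simpa using h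
    obtain ⟨h1, h2⟩ := hact (q.map (· + 1)) (by simpa using hq) b
    simp only [fcfs, Bool.false_eq_true, if_false, List.append_nil]
    exact ⟨h1.trans (minimaSum_succ ai q), h2.trans (minimaLast_succ ai q)⟩

theorem fcfs_step_length (s : QueueState) (a b : Bool) : (fcfs.step s a b).queue.length
    = s.queue.length + (if a then 1 else 0) - (if b then 1 else 0) := by
  rw [fcfs, actuateQueue_length]
  cases a <;> simp

/-- Geometric drift of `w ^ ai * x ^ n`, where `n` is the queue length. With `x = 1 + (l2 - l1)`,
the factor `x ^ n` contracts by a constant factor while the queue is not empty, and a base `w` that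
is sufficiently close to `1` does not spoil this. From an
empty queue the chain moves to the AoAI `1` if a packet arrives and is actuated at once, which gives
the constant term, and the weighted
probabilities of the other events add up to less than one. -/
theorem fcfs_exists_geometric_drift {l1 l2 : ℝ} (hl1 : 0 < l1) (hl2' : l2 ≤ 1) (hlt : l1 < l2) :
    ∃ w x r : ℝ, 1 < w ∧ 1 < x ∧ r < 1 ∧ ∀ s,
      fcfs.transition l1 l2 (fun u => w ^ u.ai * x ^ u.queue.length) s
        ≤ r * (w ^ s.ai * x ^ s.queue.length) + w := by
  set x := 1 + (l2 - l1) with hx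
  have hx1 : 1 < x := by linarith
  have hl2 : 0 < l2 := hl1.trans hlt
  have h1 : l1 ∈ Set.Icc (0 : ℝ) 1 := ⟨hl1.le, by linarith⟩
  have h2 : l2 ∈ Set.Icc (0 : ℝ) 1 := ⟨hl2.le, hl2'⟩
  have c1 : 0 ≤ 1 - l1 := by linarith
  have c2 : 0 ≤ 1 - l2 := by linarith
  set σ := 1 - l1 + l1 * (1 - l2) * x with hσ
  have hσ1 : σ < 1 := by
    have : σ = 1 - l1 * (l1 + l2 * (l2 - l1)) := by rw [hσ, hx]; ring
    have h3 : 0 < l1 * (l1 + l2 * (l2 - l1)) :=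
      mul_pos hl1 (add_pos hl1 (mul_pos hl2 (by linarith)))
    linarith
  have hσ0 : 0 ≤ σ := add_nonneg c1 (mul_nonneg (mul_nonneg hl1.le c2) (by linarith))
  set ρ := (1 - l1 + l1 * x) * (l2 + (1 - l2) * x) / x with hρ
  have hρx : ρ * x = (1 - l1 + l1 * x) * (l2 + (1 - l2) * x) := by
    rw [hρ, div_mul_cancel₀ _ (by linarith)]
  have hρ1 : ρ < 1 := by
    rw [hρ, div_lt_one (by linarith)]
    have : (1 - l1 + l1 * x) * (l2 + (1 - l2) * x)
        = x - (l2 - l1) ^ 2 * ((1 - l1) + l1 * l2) := by rw [hx]; ring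
    have h3 : 0 < (l2 - l1) ^ 2 * ((1 - l1) + l1 * l2) :=
      mul_pos (pow_pos (by linarith) 2) (add_pos_of_nonneg_of_pos c1 (mul_pos hl1 hl2))
    linarith
  set μ := max σ ρ with hμ
  have hμ1 : μ < 1 := max_lt hσ1 hρ1
  have hμ0 : 0 ≤ μ := hσ0.trans (le_max_left _ _)
  set w := 2 / (1 + μ) with hw
  have hw1 : 1 < w := by rw [hw, lt_div_iff₀ (by linarith)]; linarith
  have hwμ : w * μ < 1 := by
    rw [hw, div_mul_eq_mul_div, div_lt_one (by linarith)]; linarith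
  refine ⟨w, x, w * μ, hw1, hx1, hwμ, fun s => ?_⟩
  have hpow : ∀ a b, w ^ (fcfs.step s a b).ai * x ^ (fcfs.step s a b).queue.length
      ≤ w ^ (s.ai + 1) * x ^ (s.queue.length + (if a then 1 else 0) - (if b then 1 else 0)) :=
    fun a b => by
      rw [fcfs_step_length]
      refine mul_le_mul_of_nonneg_right ?_ (by positivity)
      exact pow_le_pow_right₀ hw1.le (actuateQueue_ai_le s.ai _ b)
  rw [SlottedSystem.transition_apply]
  have htt := mul_le_mul_of_nonneg_left (hpow true true) (mul_nonneg hl1.le hl2.le)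
  have htf := mul_le_mul_of_nonneg_left (hpow true false) (mul_nonneg hl1.le c2)
  have hft := mul_le_mul_of_nonneg_left (hpow false true) (mul_nonneg c1 hl2.le)
  have hff := mul_le_mul_of_nonneg_left (hpow false false) (mul_nonneg c1 c2)
  obtain ⟨ai, q⟩ := s
  have hwai : 0 ≤ w ^ ai * w := by positivity
  cases q with
  | nil =>
    have hres : fcfs.step ⟨ai, []⟩ true true = ⟨1, []⟩ := by simp [fcfs, actuateQueue]
    rw [hres]
    simp at htf hft hff ⊢
    have h3 := mul_le_mul_of_nonneg_left (le_max_left σ ρ) hwai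
    have h4 : l1 * l2 * w ≤ 1 * w := mul_le_mul_of_nonneg_right
      (mul_le_one₀ h1.2 hl2.le hl2') (by linarith)
    have h5 : w ^ ai * w * σ = l1 * (1 - l2) * (w ^ (ai + 1) * x) + (1 - l1) * l2 * w ^ (ai + 1)
        + (1 - l1) * (1 - l2) * w ^ (ai + 1) := by rw [hσ]; ring
    linarith
  | cons p q =>
    simp at htt htf hft hff ⊢
    have h3 := mul_le_mul_of_nonneg_left (le_max_right σ ρ)
      (mul_nonneg hwai (pow_nonneg (zero_le_one.trans hx1.le) (q.length + 1)))
    have h5 : w ^ ai * w * x ^ (q.length + 1) * ρ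
        = l1 * l2 * (w ^ (ai + 1) * x ^ (q.length + 1))
        + l1 * (1 - l2) * (w ^ (ai + 1) * x ^ (q.length + 1 + 1))
        + (1 - l1) * l2 * (w ^ (ai + 1) * x ^ q.length)
        + (1 - l1) * (1 - l2) * (w ^ (ai + 1) * x ^ (q.length + 1)) := by
      linear_combination w ^ ai * w * x ^ q.length * hρx
    linarith

theorem fcfs_hasStationaryAverage {l1 l2 : ℝ} (hl1 : 0 < l1) (hl2' : l2 ≤ 1) (hlt : l1 < l2) :
    fcfs.HasStationaryAverage l1 l2
      ((l1 ^ 2 * (l2 - 1) * (l1 - l2) + l2 ^ 3 * (l1 - 1)) / (l1 * (l1 - l2) * l2 ^ 2)) := by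
  have hl2 : 0 < l2 := hl1.trans hlt
  have h1 : l1 ∈ Set.Icc (0 : ℝ) 1 := ⟨hl1.le, by linarith⟩
  have h2 : l2 ∈ Set.Icc (0 : ℝ) 1 := ⟨hl2.le, hl2'⟩
  refine ⟨exists_isStationary_of_queue (r := ⟨1, []⟩) hl1 hl2' hlt (fun ai => ?_)
    fcfs_step_length, fun V hV => ?_⟩
  · simp [fcfs, actuateQueue]
  have hE : Summable fun s : QueueState => V s * ((s.queue.length + 1) ^ 2 * (s.ai + 1) : ℝ) := by
    obtain ⟨w, x, r, hw, hx, hr, hdrift⟩ := fcfs_exists_geometric_drift hl1 hl2' hlt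
    have hsum := hV.summable_of_drift h1 h2
      (U := fun u => w ^ u.ai * x ^ u.queue.length)
      (f := fun u => (1 - r) * (w ^ u.ai * x ^ u.queue.length)) (C := w)
      (fun s => by positivity) (fun s => mul_nonneg (by linarith) (by positivity)) (by linarith)
      fun s => by linarith [hdrift s]
    obtain ⟨c, hc⟩ : ∃ c : ℝ, ∀ n : ℕ, ((n : ℝ) + 1) ^ 2 ≤ c * x ^ n := by
      obtain ⟨c, hc⟩ := (tendsto_pow_const_div_const_pow_of_one_lt 2 hx).bddAbove_range
      refine ⟨2 * c + 2, fun n => ?_⟩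
      have h3 : (n : ℝ) ^ 2 / x ^ n ≤ c := hc ⟨n, rfl⟩
      rw [div_le_iff₀ (by positivity)] at h3
      have h4 : 1 ≤ x ^ n := one_le_pow₀ hx.le
      nlinarith [sq_nonneg ((n : ℝ) - 1)]
    have hd : ∀ n : ℕ, (n : ℝ) + 1 ≤ (1 + (w - 1)⁻¹) * w ^ n := fun n => by
      have h3 := one_add_mul_le_pow (a := w - 1) (by linarith) n
      rw [add_sub_cancel] at h3
      have h4 : (w - 1)⁻¹ * (1 + n * (w - 1)) ≤ (w - 1)⁻¹ * w ^ n :=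
        mul_le_mul_of_nonneg_left h3 (inv_nonneg.2 (by linarith))
      have h5 : (w - 1)⁻¹ * (1 + n * (w - 1)) = (w - 1)⁻¹ + n := by
        have : w - 1 ≠ 0 := by linarith
        field_simp
      have h6 : 0 ≤ (w - 1)⁻¹ := inv_nonneg.2 (by linarith)
      have h7 : 1 ≤ w ^ n := one_le_pow₀ hw.le
      linarith
    refine hV.summable_of_le (c * (1 + (w - 1)⁻¹) * (1 - r)⁻¹) hsum fun s => ?_
    rw [abs_of_nonneg (by positivity)]
    have h3 := mul_le_mul (hc s.queue.length) (hd s.ai) (by positivity)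
      ((by positivity : (0 : ℝ) ≤ ((s.queue.length : ℝ) + 1) ^ 2).trans (hc _))
    refine h3.trans_eq ?_
    have : 1 - r ≠ 0 := by linarith
    field_simp
  -- The coefficients come from matching the drifts of `minimaSum`, `n ^ 2`, `n`, `y * z ^ n` and
  -- `z ^ n`, where `n` is the queue length and `y` is `minimaLast`. The first of these produces the
  -- AoAI, and, since a permission is lost on an empty queue, a multiple of `y` on `n = 0`. The
  -- value of `z` is the one for which the drift of `y * z ^ n` contains `y` only on `n = 0`.
  have hs : 0 < l1 + l2 - l1 * l2 := by nlinarith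
  have hc1 : 0 < 1 - l1 := by linarith
  have hd : 0 < l2 - l1 := by linarith
  obtain ⟨z, hz⟩ : ∃ z, z = l2 * (1 - l1) / (l1 + l2 - l1 * l2) := ⟨_, rfl⟩
  obtain ⟨γ, hγ⟩ : ∃ γ, γ = 1 / (2 * (l2 - l1)) := ⟨_, rfl⟩
  obtain ⟨α, hα⟩ : ∃ α, α = (1 - l1) * l2 / l1 := ⟨_, rfl⟩
  obtain ⟨δ, hδ⟩ : ∃ δ, δ = -α * (l1 + l2) / (l1 * l2) := ⟨_, rfl⟩
  obtain ⟨β, hβ⟩ : ∃ β, β = γ + δ * l1 / (l2 * (1 - l1)) := ⟨_, rfl⟩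
  obtain ⟨v, hv⟩ : ∃ v, v = (l1 ^ 2 * (l2 - 1) * (l1 - l2) + l2 ^ 3 * (l1 - 1))
    / (l1 * (l1 - l2) * l2 ^ 2) := ⟨_, rfl⟩
  have hz0 : 0 ≤ z := by rw [hz]; positivity
  have hz1 : z ≤ 1 := by rw [hz, div_le_one hs]; nlinarith
  have ez : (1 - l1) * (l2 + (1 - l2) * z) = z := by rw [hz]; field_simp; ring
  have eγ : 2 * γ * (l2 - l1) = 1 := by rw [hγ]; field_simp
  have eα : α * l1 = (1 - l1) * l2 := by rw [hα]; field_simp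
  have eδ : α * (l1 * (l2 + (1 - l2) * z) + 1) + δ * (l1 * (l2 + (1 - l2) * z)) = 0 := by
    rw [hδ, hz]; field_simp; ring
  have eβ : (β - γ) * (l2 * (1 - l1)) = δ * l1 := by
    rw [hβ]; field_simp; ring
  have ev : 1 + l1 - l2 + β * (l1 - l2) + γ * (l1 + l2 - 2 * l1 * l2) = l2 * v := by
    have : l1 - l2 ≠ 0 := by linarith
    rw [hv, hβ, hδ, hα, hγ]; field_simp; ring
  rw [← hv]
  set g : QueueState → ℝ := fun s => l2⁻¹ * (minimaSum s.ai s.queue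
    + γ * s.queue.length ^ 2 + β * s.queue.length
    + α * minimaLast s.ai s.queue * z ^ s.queue.length + δ * z ^ s.queue.length) with hg
  have hgV : Summable fun s => V s * g s := by
    refine hV.summable_of_le (l2⁻¹ * (1 + |γ| + |β| + |α| + |δ|)) hE fun s => ?_
    have hsm : (minimaSum s.ai s.queue : ℝ) ≤ (s.queue.length + 1) * s.ai := by
      exact_mod_cast minimaSum_le s.ai s.queue
    have hlast : (minimaLast s.ai s.queue : ℝ) ≤ s.ai := by
      exact_mod_cast minimaLast_le s.ai s.queue
    have hzn : z ^ s.queue.length ≤ 1 := pow_le_one₀ hz0 hz1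
    have hzn0 : 0 ≤ z ^ s.queue.length := pow_nonneg hz0 _
    set t := z ^ s.queue.length
    set S := (minimaSum s.ai s.queue : ℝ) with hS
    set L := (minimaLast s.ai s.queue : ℝ) with hL
    set n := (s.queue.length : ℝ) with hn
    set D := ((n + 1) ^ 2 * (s.ai + 1) : ℝ) with hD
    have hn0 : 0 ≤ n := Nat.cast_nonneg _
    have ha0 : (0 : ℝ) ≤ s.ai := Nat.cast_nonneg _
    have hL0 : 0 ≤ L := Nat.cast_nonneg _
    have hS0 : 0 ≤ S := Nat.cast_nonneg _
    have hna : 0 ≤ n * s.ai := mul_nonneg hn0 ha0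
    have hnna : 0 ≤ n * (n * s.ai) := mul_nonneg hn0 hna
    have hDe : D = n * (n * s.ai) + 2 * (n * s.ai) + s.ai + n ^ 2 + 2 * n + 1 := by rw [hD]; ring
    have hn2 : 0 ≤ n ^ 2 := sq_nonneg n
    have b1 : |S| ≤ D := by rw [abs_of_nonneg hS0]; linarith
    have b2 : |γ * n ^ 2| ≤ |γ| * D := by
      rw [abs_mul, abs_of_nonneg hn2]
      exact mul_le_mul_of_nonneg_left (by linarith) (abs_nonneg _)
    have b3 : |β * n| ≤ |β| * D := by
      rw [abs_mul, abs_of_nonneg hn0]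
      exact mul_le_mul_of_nonneg_left (by linarith) (abs_nonneg _)
    have b4 : |α * L * t| ≤ |α| * D := by
      rw [mul_assoc, abs_mul, abs_of_nonneg (mul_nonneg hL0 hzn0)]
      exact mul_le_mul_of_nonneg_left
        (by linarith [mul_le_mul_of_nonneg_left hzn hL0]) (abs_nonneg _)
    have b5 : |δ * t| ≤ |δ| * D := by
      rw [abs_mul, abs_of_nonneg hzn0]
      exact mul_le_mul_of_nonneg_left (by linarith) (abs_nonneg _)
    have hg' : g s = l2⁻¹ * (S + γ * n ^ 2 + β * n + α * L * t + δ * t) := rfl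
    rw [hg', abs_mul, abs_of_nonneg (inv_nonneg.2 hl2.le), mul_assoc l2⁻¹]
    refine mul_le_mul_of_nonneg_left ?_ (inv_nonneg.2 hl2.le)
    have := abs_add_le (S + γ * n ^ 2 + β * n + α * L * t) (δ * t)
    have := abs_add_le (S + γ * n ^ 2 + β * n) (α * L * t)
    have := abs_add_le (S + γ * n ^ 2) (β * n)
    have := abs_add_le S (γ * n ^ 2)
    linarith
  refine hV.hasSum_of_poisson h1 h2 hgV fun s => ?_
  obtain ⟨ai, q⟩ := s
  have hstep : ∀ a b, q ≠ [] ∨ a = true → g (fcfs.step ⟨ai, q⟩ a b)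
      = l2⁻¹ * (minimaSum ai q + q.length + 1 + (if a then 1 else 0) - (if b then ai + 1 else 0)
        + γ * (q.length + (if a then 1 else 0) - (if b then 1 else 0)) ^ 2
        + β * (q.length + (if a then 1 else 0) - (if b then 1 else 0))
        + α * (if a then 1 else minimaLast ai q + 1)
          * z ^ (q.length + (if a then 1 else 0) - (if b then 1 else 0))
        + δ * z ^ (q.length + (if a then 1 else 0) - (if b then 1 else 0))) := by
    intro a b hab
    obtain ⟨hsum, hlast⟩ := fcfs_step_minima ai q a b hab
    have hle : (if b then 1 else 0) ≤ q.length + (if a then 1 else 0) := by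
      rcases hab with hq | rfl
      · have := List.length_pos_iff.2 hq
        split_ifs <;> omega
      · cases b <;> simp
    have hsum' := eq_sub_of_add_eq (congrArg (Nat.cast : ℕ → ℝ) hsum |>.symm.trans
      (Nat.cast_add _ _)).symm
    simp only [hg, hlast, hsum', fcfs_step_length, Nat.cast_sub hle]
    push_cast
    ring
  rw [SlottedSystem.transition_apply, hstep true true (Or.inr rfl), hstep true false (Or.inr rfl),
    show fcfs.aoai ⟨ai, q⟩ = ai from rfl]
  cases q with
  | nil =>
    have hidle : ∀ b, g (fcfs.step ⟨ai, []⟩ false b) = l2⁻¹ * (ai + 1 + α * (ai + 1) + δ) := by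
      intro b
      cases b <;> simp [hg, fcfs, actuateQueue, minimaSum, minimaLast]
    rw [hidle, hidle]
    simp [hg, minimaSum, minimaLast]
    field_simp
    linear_combination ev - (ai + 1) * eα + eδ + eβ
  | cons p q =>
    rw [hstep false true (by simp), hstep false false (by simp)]
    simp [hg]
    field_simp
    linear_combination ev - (q.length + 1) * eγ
      + z ^ q.length * (α * (minimaLast ai (p :: q) + 1) + δ) * ez + z ^ (q.length + 1) * eδ

/-! ### The battery -/

/-- The AoAI that an actuation of the stored packet would result in if ages did not grow. -/
def BatteryState.freshestAge (s : BatteryState) : ℕ := min s.ai (s.buffer.getD s.ai)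

theorem BatteryState.freshestAge_le (s : BatteryState) : s.freshestAge ≤ s.ai := min_le_left _ _

theorem battery_step_freshestAge (s : BatteryState) (a b : Bool) :
    (battery.step s a b).freshestAge = if a then 1 else s.freshestAge + 1 := by
  obtain ⟨ai, q, e⟩ := s
  cases q <;> cases e <;> cases a <;> cases b <;>
    simp [battery, refresh, BatteryState.freshestAge]

theorem battery_step_ai_le (s : BatteryState) (a b : Bool) :
    (battery.step s a b).ai ≤ (if b then s.freshestAge else s.ai) + 1 := by
  obtain ⟨ai, q, e⟩ := s
  cases q <;> cases e <;> cases a <;> cases b <;>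
    simp [battery, refresh, BatteryState.freshestAge]

/-- With the battery system, the AoAI is integrable under every stationary distribution. The
freshest age `y` has drift `1 - l1 * y`, and a harvest brings the AoAI down to at most `y + 1`, so
that the AoAI plus `l2 / l1 * y` has drift at most `1 + l2 / l1` minus `l2` times the AoAI. -/
theorem battery_summable_ai {l1 l2 : ℝ} (hl1 : 0 < l1) (hl1' : l1 ≤ 1) (hl2 : 0 < l2)
    (hl2' : l2 ≤ 1) {V : BatteryState → ℝ} (hV : battery.IsStationary l1 l2 V) :
    Summable fun s => V s * (s.ai + 1 : ℝ) := by
  have h1 : l1 ∈ Set.Icc (0 : ℝ) 1 := ⟨hl1.le, hl1'⟩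
  have h2 : l2 ∈ Set.Icc (0 : ℝ) 1 := ⟨hl2.le, hl2'⟩
  have hsum : Summable fun s => V s * (l2 * s.ai) := by
    refine hV.summable_of_drift h1 h2 (U := fun s => s.ai + l2 / l1 * s.freshestAge)
      (C := 1 + l2 / l1) (fun s => by positivity) (fun s => by positivity) (by positivity)
      fun s => ?_
    have hai : battery.transition l1 l2 (fun u => (u.ai : ℝ)) s
        ≤ (1 - l2) * s.ai + l2 * s.freshestAge + 1 := by
      have hle : ∀ a b, ((battery.step s a b).ai : ℝ)
          ≤ (if b then s.freshestAge else s.ai : ℕ) + 1 := fun a b => by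
        exact_mod_cast battery_step_ai_le s a b
      have htt := mul_le_mul_of_nonneg_left (hle true true) (mul_nonneg hl1.le hl2.le)
      have htf := mul_le_mul_of_nonneg_left (hle true false)
        (mul_nonneg hl1.le (sub_nonneg.2 hl2'))
      have hft := mul_le_mul_of_nonneg_left (hle false true)
        (mul_nonneg (sub_nonneg.2 hl1') hl2.le)
      have hff := mul_le_mul_of_nonneg_left (hle false false)
        (mul_nonneg (sub_nonneg.2 hl1') (sub_nonneg.2 hl2'))
      rw [SlottedSystem.transition_apply]
      simp only [if_true, Bool.false_eq_true, if_false] at htt htf hft hff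
      linarith
    have hy : battery.transition l1 l2 (fun u => (u.freshestAge : ℝ)) s
        = 1 + (1 - l1) * s.freshestAge := by
      rw [SlottedSystem.transition_apply]
      simp only [battery_step_freshestAge]
      push_cast
      ring
    rw [SlottedSystem.transition_add, SlottedSystem.transition_mul_left, hy]
    have : l2 / l1 * (1 + (1 - l1) * s.freshestAge)
        = l2 / l1 + l2 / l1 * s.freshestAge - l2 * s.freshestAge := by
      field_simp; ring
    linarith
  have := (hsum.mul_left l2⁻¹).add hV.total.summable
  refine this.congr fun s => ?_
  field_simp

/-- The state to which the battery system returns is the one after a received packet has been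
actuated at once, with the battery then empty, or, if `l2 = 1`, full. For `l2 < 1` this state is
reached in one slot from every state with a probability that is bounded below. -/
theorem battery_exists_isStationary {l1 l2 : ℝ} (hl1 : 0 < l1) (hl1' : l1 ≤ 1) (hl2 : 0 < l2)
    (hl2' : l2 ≤ 1) (h : ¬(l1 = 1 ∧ l2 = 1)) : ∃ V, battery.IsStationary l1 l2 V := by
  classical
  have h1 : l1 ∈ Set.Icc (0 : ℝ) 1 := ⟨hl1.le, hl1'⟩
  have h2 : l2 ∈ Set.Icc (0 : ℝ) 1 := ⟨hl2.le, hl2'⟩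
  rcases hl2'.lt_or_eq with hlt | rfl
  · set ε := min (l1 * l2) (l1 * (1 - l2)) with hε
    have hε0 : 0 < ε := lt_min (mul_pos hl1 hl2) (mul_pos hl1 (by linarith))
    refine SlottedSystem.exists_isStationary h1 h2 ⟨1, none, false⟩ (fun _ => ε⁻¹)
      (fun _ => by positivity) fun s => ?_
    have hle : ∀ u : BatteryState, (if u = ⟨1, none, false⟩ then 0 else ε⁻¹) ≤ ε⁻¹ :=
      fun u => by split_ifs <;> first | exact le_rfl | positivity
    have hε1 : ε * ε⁻¹ = 1 := mul_inv_cancel₀ hε0.ne'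
    have htt := mul_le_mul_of_nonneg_left (hle (battery.step s true true))
      (mul_nonneg hl1.le hl2.le)
    have htf := mul_le_mul_of_nonneg_left (hle (battery.step s true false))
      (mul_nonneg hl1.le (sub_nonneg.2 hl2'))
    have hft := mul_le_mul_of_nonneg_left (hle (battery.step s false true))
      (mul_nonneg (sub_nonneg.2 hl1') hl2.le)
    have hff := mul_le_mul_of_nonneg_left (hle (battery.step s false false))
      (mul_nonneg (sub_nonneg.2 hl1') (sub_nonneg.2 hl2'))
    rw [SlottedSystem.taboo, SlottedSystem.transition_apply]
    obtain ⟨ai, q, e⟩ := s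
    cases e with
    | false =>
      have hreset : battery.step ⟨ai, q, false⟩ true true = ⟨1, none, false⟩ := by
        simp [battery, refresh]
      have := mul_le_mul_of_nonneg_right (min_le_left (l1 * l2) (l1 * (1 - l2)))
        (inv_nonneg.2 hε0.le)
      rw [hreset, if_pos rfl]
      linarith
    | true =>
      have hreset : battery.step ⟨ai, q, true⟩ true false = ⟨1, none, false⟩ := by
        simp [battery, refresh]
      have := mul_le_mul_of_nonneg_right (min_le_right (l1 * l2) (l1 * (1 - l2)))
        (inv_nonneg.2 hε0.le)
      rw [hreset, if_pos rfl]
      linarith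
  · have hl1'' : 0 < 1 - l1 := sub_pos.2 (lt_of_le_of_ne hl1' fun h' => h ⟨h', rfl⟩)
    -- A stored packet is actuated within one slot; then a slot without an arrival fills the battery,
    -- and the next arrival leads to the state in question.
    set W : BatteryState → ℝ := fun s => l1⁻¹ + (if s.full then 0 else (1 - l1)⁻¹)
      + (if s.buffer = none then 0 else 1) with hW
    have hW0 : ∀ s, 0 ≤ W s := fun s => by
      have h3 : 0 ≤ l1⁻¹ := inv_nonneg.2 hl1.le
      have h4 : 0 ≤ (1 - l1)⁻¹ := inv_nonneg.2 hl1''.le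
      simp only [hW]; split_ifs <;> linarith
    refine SlottedSystem.exists_isStationary h1 h2 ⟨1, none, true⟩ W hW0 fun s => ?_
    have h3 : l1 * l1⁻¹ = 1 := mul_inv_cancel₀ hl1.ne'
    have h4 : (1 - l1) * (1 - l1)⁻¹ = 1 := mul_inv_cancel₀ hl1''.ne'
    have hle : ∀ u, (if u = ⟨1, none, true⟩ then 0 else W u) ≤ W u :=
      fun u => by split_ifs <;> simp [hW0]
    have htt := mul_le_mul_of_nonneg_left (hle (battery.step s true true)) hl1.le
    have hft := mul_le_mul_of_nonneg_left (hle (battery.step s false true)) hl1''.le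
    rw [SlottedSystem.taboo, SlottedSystem.transition_apply]
    obtain ⟨ai, q, e⟩ := s
    cases q <;> cases e <;>
      simp [battery, refresh, hW] at htt hft ⊢ <;>
      nlinarith

theorem battery_hasStationaryAverage {l1 l2 : ℝ} (hl1 : 0 < l1) (hl1' : l1 ≤ 1) (hl2 : 0 < l2)
    (hl2' : l2 ≤ 1) (h : ¬(l1 = 1 ∧ l2 = 1)) :
    battery.HasStationaryAverage l1 l2
      ((l1 ^ 4 * (l2 - 4) * (l2 - 1) ^ 3 * l2 - 4 * l1 ^ 3 * (l2 - 1) ^ 3 * l2 ^ 2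
          + l1 * (3 - 4 * l2) * l2 ^ 4 + l2 ^ 5 + l1 ^ 5 * (l2 - 1) ^ 3 * (2 * l2 - 1)
          + 2 * l1 ^ 2 * l2 ^ 3 * (2 - 5 * l2 + 3 * l2 ^ 2))
        / (l1 * l2 * (l1 + l2 - l1 * l2) ^ 2
          * (l1 ^ 2 * (l2 - 1) ^ 2 + l2 ^ 2 + l1 * (l2 - 2 * l2 ^ 2)))) := by
  have h1 : l1 ∈ Set.Icc (0 : ℝ) 1 := ⟨hl1.le, hl1'⟩
  have h2 : l2 ∈ Set.Icc (0 : ℝ) 1 := ⟨hl2.le, hl2'⟩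
  refine ⟨battery_exists_isStationary hl1 hl1' hl2 hl2' h, fun V hV => ?_⟩
  have hq1 : 0 ≤ 1 - l1 := sub_nonneg.2 hl1'
  have hq2 : 0 ≤ 1 - l2 := sub_nonneg.2 hl2'
  have hor : 0 < 1 - l1 ∨ 0 < 1 - l2 := by
    by_contra! hcon
    exact h ⟨by linarith, by linarith⟩
  have hs : 0 < l1 + l2 - l1 * l2 := by nlinarith
  have hw : 0 < l1 * (1 - l2) + (1 - l1) * l2 := by
    rcases hor with h' | h'
    · exact add_pos_of_nonneg_of_pos (mul_nonneg hl1.le hq2) (mul_pos h' hl2)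
    · exact add_pos_of_pos_of_nonneg (mul_pos hl1 h') (mul_nonneg hq1 hl2.le)
  have hD : 0 < l1 ^ 2 * (l2 - 1) ^ 2 + l2 ^ 2 + l1 * (l2 - 2 * l2 ^ 2) := by
    have hD' : l1 ^ 2 * (l2 - 1) ^ 2 + l2 ^ 2 + l1 * (l2 - 2 * l2 ^ 2)
        = (l1 * (1 - l2)) ^ 2 + l2 * (l1 * (1 - l2) + (1 - l1) * l2) := by ring
    rw [hD']
    exact add_pos_of_nonneg_of_pos (sq_nonneg _) (mul_pos hl2 hw)
  obtain ⟨v, hv⟩ : ∃ v, v = (l1 ^ 4 * (l2 - 4) * (l2 - 1) ^ 3 * l2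
      - 4 * l1 ^ 3 * (l2 - 1) ^ 3 * l2 ^ 2
      + l1 * (3 - 4 * l2) * l2 ^ 4 + l2 ^ 5 + l1 ^ 5 * (l2 - 1) ^ 3 * (2 * l2 - 1)
      + 2 * l1 ^ 2 * l2 ^ 3 * (2 - 5 * l2 + 3 * l2 ^ 2))
    / (l1 * l2 * (l1 + l2 - l1 * l2) ^ 2
      * (l1 ^ 2 * (l2 - 1) ^ 2 + l2 ^ 2 + l1 * (l2 - 2 * l2 ^ 2))) := ⟨_, rfl⟩
  rw [← hv]
  -- The solution of the Poisson equation is affine in the AoAI and the freshest age, with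
  -- coefficients that depend on whether a packet and an energy unit are stored.
  obtain ⟨α, hα⟩ : ∃ α, α = 1 / l2 := ⟨_, rfl⟩
  obtain ⟨c1, hc1⟩ : ∃ c1, c1 = 1 / l1 := ⟨_, rfl⟩
  obtain ⟨c0, hc0⟩ : ∃ c0, c0 = (l1 * l2 + l1 ^ 2 * (1 - l2) + (1 - l1) * l2 ^ 2)
    / (l1 * l2 * (l1 + l2 - l1 * l2)) := ⟨_, rfl⟩
  obtain ⟨c2, hc2⟩ : ∃ c2, c2 = (1 - l1) * l2 * c0 / (l1 + l2 - l1 * l2) := ⟨_, rfl⟩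
  obtain ⟨k2, hk2⟩ : ∃ k2, k2 = (l2 * c0 + (1 - l2) * (α + c2) - v) / l2 := ⟨_, rfl⟩
  obtain ⟨A, hA⟩ : ∃ A, A = (l1 * l2 + 1 - l1) * c1 + l1 * (1 - l2) * c0 := ⟨_, rfl⟩
  obtain ⟨B, hB⟩ : ∃ B, B = l1 * l2 * c0 + l1 * (1 - l2) * (α + c2 + k2) + (1 - l1) * l2 * c1
    + (1 - l1) * (1 - l2) * c0 := ⟨_, rfl⟩
  obtain ⟨k1, hk1⟩ : ∃ k1, k1 = (A - B) / (l1 * (1 - l2) + (1 - l1) * l2) := ⟨_, rfl⟩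
  have eα : (1 - l2) * α = α - 1 := by rw [hα]; field_simp
  have ec1 : (1 - l1) * c1 = c1 - 1 := by rw [hc1]; field_simp
  have ec0 : l1 * (1 - l2) * α + (1 - l1) * l2 * c1 + (1 - l1) * (1 - l2) * c0 = c0 - 1 := by
    rw [hα, hc1, hc0]; field_simp; ring
  have ec2 : (1 - l1) * l2 * c0 + (1 - l1) * (1 - l2) * c2 = c2 := by
    rw [hc2]; field_simp; ring
  have ek2 : l2 * c0 + (1 - l2) * (α + c2) - l2 * k2 = v := by rw [hk2]; field_simp; ring
  have hAB : (A - v) * ((1 - l1) * l2) = (v - B) * (l1 * (1 - l2)) := by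
    have hvD : v * (l1 ^ 2 * (l2 - 1) ^ 2 + l2 ^ 2 + l1 * (l2 - 2 * l2 ^ 2))
        = A * (1 - l1) * l2 ^ 2 + l1 * (1 - l2) * (l2 * (B - l1 * (1 - l2) * k2)
          + l1 * (1 - l2) * (l2 * c0 + (1 - l2) * (α + c2))) := by
      rw [hv, ← div_div, div_mul_cancel₀ _ hD.ne', hA, hB, hc2, hc0, hc1, hα]
      field_simp
      ring
    refine mul_left_cancel₀ hl2.ne' ?_
    linear_combination -hvD - l1 ^ 2 * (1 - l2) ^ 2 * ek2
  have ek : k1 * (l1 * (1 - l2) + (1 - l1) * l2) = A - B := by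
    rw [hk1, div_mul_cancel₀ _ hw.ne']
  have ek1 : A - l1 * (1 - l2) * k1 = v := by
    refine mul_left_cancel₀ hw.ne' ?_
    linear_combination hAB - l1 * (1 - l2) * ek
  have ek0 : B + (1 - l1) * l2 * k1 = v := by
    refine mul_left_cancel₀ hw.ne' ?_
    linear_combination hAB + (1 - l1) * l2 * ek
  obtain ⟨d, hd⟩ : ∃ d, d = (1 - l1) * l2 * c1 + (1 - l1) * (1 - l2) * c0 := ⟨_, rfl⟩
  obtain ⟨k, hk⟩ : ∃ k, k = l2 * (c1 + k1) + (1 - l2) * c0 - v := ⟨_, rfl⟩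
  set g : BatteryState → ℝ := fun s =>
    match s.buffer, s.full with
    | none, false => c0 * s.freshestAge
    | none, true => c1 * s.freshestAge + k1
    | some _, false => α * s.ai + c2 * s.freshestAge + k2
    | some _, true => s.ai + d * s.freshestAge + k with hg
  have hgV : Summable fun s => V s * g s := by
    refine hV.summable_of_le (1 + |α| + |c0| + |c1| + |k1| + |c2| + |k2| + |d| + |k|)
      (battery_summable_ai hl1 hl1' hl2 hl2' hV) fun s => ?_
    have hai : (0 : ℝ) ≤ s.ai := Nat.cast_nonneg _
    have hy0 : (0 : ℝ) ≤ s.freshestAge := Nat.cast_nonneg _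
    have hy1 : (s.freshestAge : ℝ) ≤ s.ai := by exact_mod_cast s.freshestAge_le
    have hmul : ∀ c t : ℝ, 0 ≤ t → t ≤ s.ai + 1 → |c * t| ≤ |c| * (s.ai + 1) :=
      fun c t h0 ht => by
        rw [abs_mul, abs_of_nonneg h0]
        exact mul_le_mul_of_nonneg_left ht (abs_nonneg c)
    have hy : ∀ c : ℝ, |c * s.freshestAge| ≤ |c| * (s.ai + 1) :=
      fun c => hmul c _ hy0 (by linarith)
    have hone : ∀ c : ℝ, |c| ≤ |c| * (s.ai + 1) :=
      fun c => le_mul_of_one_le_right (abs_nonneg c) (by linarith)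
    have hpos : ∀ c : ℝ, 0 ≤ |c| * (s.ai + 1) :=
      fun c => mul_nonneg (abs_nonneg c) (by linarith)
    have hα' := hmul α s.ai hai (by linarith)
    have p1 := hpos α
    have p2 := hpos c0
    have p3 := hpos c1
    have p4 := hpos k1
    have p5 := hpos c2
    have p6 := hpos k2
    have p7 := hpos d
    have p8 := hpos k
    simp only [hg, add_mul _ _ ((s.ai : ℝ) + 1), one_mul]
    split
    · linarith [hy c0]
    · linarith [hy c1, hone k1, abs_add_le (c1 * (s.freshestAge : ℝ)) k1]
    · linarith [hy c2, hone k2, abs_add_le (α * (s.ai : ℝ) + c2 * s.freshestAge) k2,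
        abs_add_le (α * (s.ai : ℝ)) (c2 * s.freshestAge)]
    · linarith [hy d, hone k, abs_add_le ((s.ai : ℝ) + d * s.freshestAge) k,
        abs_add_le (s.ai : ℝ) (d * s.freshestAge), abs_of_nonneg hai]
  refine hV.hasSum_of_poisson h1 h2 hgV fun s => ?_
  rw [SlottedSystem.transition_apply]
  obtain ⟨ai, q, e⟩ := s
  cases q with
  | none =>
    cases e <;> simp [hg, battery, refresh, BatteryState.freshestAge]
    · linear_combination ai * ec0 + ek0 - hB
    · linear_combination ai * ec1 + ek1 - hA
  | some p =>
    cases e <;> simp [hg, battery, refresh, BatteryState.freshestAge, min_add_add_right]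
    · linear_combination ai * eα + min (ai : ℝ) p * ec2 + ek2
    · rw [hd, hk]; ring

end AoAI

theorem theorem2 (l1 l2 : ℝ) (hl1 : 0 < l1) (hl1' : l1 ≤ 1) (hl2 : 0 < l2) (hl2' : l2 ≤ 1) :
    (l1 < l2 →
      AoAI.fcfs.HasStationaryAverage l1 l2
        ((l1 ^ 2 * (l2 - 1) * (l1 - l2) + l2 ^ 3 * (l1 - 1)) / (l1 * (l1 - l2) * l2 ^ 2))) ∧
    AoAI.lcfs.HasLimitingAverage l1 l2 (1 / l1 + 1 / l2 - 1) ∧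
    (l1 < l2 → AoAI.lcfs.HasStationaryAverage l1 l2 (1 / l1 + 1 / l2 - 1)) ∧
    AoAI.singleBuffer.HasStationaryAverage l1 l2 (1 / l1 + 1 / l2 - 1) ∧
    (¬(l1 = 1 ∧ l2 = 1) →
      AoAI.battery.HasStationaryAverage l1 l2
        ((l1 ^ 4 * (l2 - 4) * (l2 - 1) ^ 3 * l2 - 4 * l1 ^ 3 * (l2 - 1) ^ 3 * l2 ^ 2
            + l1 * (3 - 4 * l2) * l2 ^ 4 + l2 ^ 5 + l1 ^ 5 * (l2 - 1) ^ 3 * (2 * l2 - 1)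
            + 2 * l1 ^ 2 * l2 ^ 3 * (2 - 5 * l2 + 3 * l2 ^ 2))
          / (l1 * l2 * (l1 + l2 - l1 * l2) ^ 2
            * (l1 ^ 2 * (l2 - 1) ^ 2 + l2 ^ 2 + l1 * (l2 - 2 * l2 ^ 2))))) := by
  exact ⟨AoAI.fcfs_hasStationaryAverage hl1 hl2', AoAI.lcfs_hasLimitingAverage hl1 hl1' hl2 hl2',
    AoAI.lcfs_hasStationaryAverage hl1 hl2',
    AoAI.singleBuffer_hasStationaryAverage hl1 hl1' hl2 hl2',
    AoAI.battery_hasStationaryAverage hl1 hl1' hl2 hl2'⟩
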